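/- Let $\mathbb F$ be a field of characteristic different from $2$. Let $\mathsf K_3=\mathbb F a\oplus W$ be the three-dimensional Kaplansky superalgebra: the even part is $\mathbb F a$, the odd part is $W=\mathbb F u\oplus\mathbb F v$ with the skew-symmetric bilinear form $(\cdot\mid\cdot)$ such that $(u\mid v)=1$, and $a^2=a$, $ax=xa=\tfrac12x$, $xy=(x\mid y)a$ for $x,y\in W$. Extend the form to $\mathsf K_3$ by $(a\mid a)=\tfrac12$ and $(a\mid W)=(W\mid a)=0$. Kac's superalgebra is $\mathsf K_{10}=\mathbb F1\oplus(\mathsf K_3\otimes\mathsf K_3)$, with even part $\mathbb F1\oplus\mathbb F(a\otimes a)\oplus(W\otimes W)$ and odd part $(W\otimes a)\oplus(a\otimes W)$, where $1$ is the unity and $$(x\otimes y)(z\otimes t)=(-1)^{|y||z|}\Bigl(xz\otimes yt-\tfrac34(x\mid z)(y\mid t)1\Bigr)$$ for homogeneous $x,y,z,t\in\mathsf K_3$. For an abelian group $G$, a $G$-grading on $\mathsf K_{10}$ is a decomposition $\mathsf K_{10}=\bigoplus_{g\in G}A_g$ into subspaces, each the direct sum of its intersections with the even and the odd part, with $A_gA_h\subseteq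 A_{gh}$ for all $g,h$. Two $G$-gradings $(A_g)$, $(A'_g)$ are isomorphic if some automorphism $\varphi$ of the superalgebra $\mathsf K_{10}$ satisfies $\varphi(A_g)=A'_g$ for all $g\in G$. Gradings by possibly different abelian groups are equivalent if some automorphism of $\mathsf K_{10}$ maps the nonzero homogeneous components of the first onto those of the second. A grading is fine if it has no proper refinement, that is, there is no grading by an abelian group each of whose components lies in a component of the given one, with strict inclusion for at least one nonzero component. Let $G$ be an abelian group with neutral element $e$. For $g_1,g_2\in G$ there is a unique $G$-grading $\Gamma^1_{\mathsf K_{10}}(G;g_1,g_2)$ with $$\deg(u\otimes a)=g_1=\deg(v\otimes a)^{-1},\qquad \deg(a\otimes u)=g_2=\deg(a\otimes v)^{-1},$$ and for $g,h\in G$ with $h^2=e\neq h$ there is a unique $G$-grading $\Gamma^2_{\mathsf K_{10}}(G;g,h)$ with $$\deg(u\otimes a+a\otimes u)=g=\deg(v\otimes a+a\otimes v)^{-1},\qquad \deg(u\otimes a-a\otimes u)=gh=\deg(v\otimes a-a\otimes v)^{-1}.$$ Theorem. Any $G$-grading on $\mathsf K_{10}$ is isomorphic to some $\Gamma^1_{\mathsf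 K_{10}}(G;g_1,g_2)$ or to some $\Gamma^2_{\mathsf K_{10}}(G;g,h)$ with $h^2=e\neq h$. No grading of the first type is isomorphic to a grading of the second type. Moreover: - $\Gamma^1_{\mathsf K_{10}}(G;g_1,g_2)$ and $\Gamma^1_{\mathsf K_{10}}(G;g_1',g_2')$ are isomorphic if and only if the sets $\{g_1,g_1^{-1},g_2,g_2^{-1}\}$ and $\{g_1',(g_1')^{-1},g_2',(g_2')^{-1}\}$ coincide; - $\Gamma^2_{\mathsf K_{10}}(G;g,h)$ and $\Gamma^2_{\mathsf K_{10}}(G;g',h')$ (with $h^2=e\neq h$ and $h'^2=e\neq h'$) are isomorphic if and only if $h'=h$ and $g'\in\{g,gh,g^{-1},g^{-1}h\}$. Finally, there are exactly two fine gradings on $\mathsf K_{10}$ up to equivalence: $\Gamma^1_{\mathsf K_{10}}\bigl(\mathbb Z^2;(1,0),(0,1)\bigr)$ and $\Gamma^2_{\mathsf K_{10}}\bigl(\mathbb Z\times\mathbb Z/2\mathbb Z;(1,\bar0),(0,\bar1)\bigr)$ are fine and inequivalent, and every fine grading of $\mathsf K_{10}$ by an abelian group is equivalent to one of them. -/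

import Mathlib

open scoped TensorProduct

universe u v w

noncomputable section

namespace Kac

/-! ### The three-dimensional Kaplansky superalgebra -/

/-- `K3 F = F a ⊕ W`, with `W = F²`: the pair `(α, w)` stands for `α a + w`. -/
abbrev K3 (F : Type w) [Field F] : Type w := F × (Fin 2 → F)

variable (F : Type w) [Field F]

namespace K3

/-- The even basis element `a`. -/
def a : K3 F := (1, 0)

/-- The odd element attached to a vector of `W`. -/
def odd {F : Type w} [Field F] (x : Fin 2 → F) : K3 F := (0, x)

/-- First vector of the symplectic basis of `W`. -/
def u : K3 F := odd ![1, 0]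

/-- Second vector of the symplectic basis of `W`; `(u | v) = 1`. -/
def v : K3 F := odd ![0, 1]

/-- The nonzero skew-symmetric form on `W`. -/
def skew {F : Type w} [Field F] (x y : Fin 2 → F) : F := x 0 * y 1 - x 1 * y 0

/-- The product of `K3`: `a a = a`, `a x = x a = (1/2) x`, `x y = (x | y) a` for `x, y ∈ W`. -/
def mul : K3 F →ₗ[F] K3 F →ₗ[F] K3 F :=
  LinearMap.mk₂ F
    (fun p q => (p.1 * q.1 + skew p.2 q.2, (1 / 2 : F) • (p.1 • q.2 + q.1 • p.2)))
    (by intro p p' q; ext <;> simp [skew] <;> ring)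
    (by intro c p q; ext <;> simp [skew] <;> ring)
    (by intro p q q'; ext <;> simp [skew] <;> ring)
    (by intro c p q; ext <;> simp [skew] <;> ring)

/-- The supersymmetric form on `K3`: `(a | a) = 1/2`, `(a | W) = (W | a) = 0`, and the given
skew-symmetric form on `W`. -/
def form : K3 F →ₗ[F] K3 F →ₗ[F] F :=
  LinearMap.mk₂ F
    (fun p q => (1 / 2 : F) * (p.1 * q.1) + skew p.2 q.2)
    (by intro p p' q; simp [skew]; ring)
    (by intro c p q; simp [skew]; ring)
    (by intro p q q'; simp [skew]; ring)
    (by intro c p q; simp [skew]; ring)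

/-- The projection of `K3` onto its even part. -/
def evenProj : K3 F →ₗ[F] K3 F := LinearMap.inl F F (Fin 2 → F) ∘ₗ LinearMap.fst F F (Fin 2 → F)

/-- The projection of `K3` onto its odd part. -/
def oddProj : K3 F →ₗ[F] K3 F := LinearMap.inr F F (Fin 2 → F) ∘ₗ LinearMap.snd F F (Fin 2 → F)

/-- The parity automorphism: `x ↦ (-1)^{|x|} x` on homogeneous elements. -/
def parity : K3 F →ₗ[F] K3 F := evenProj F - oddProj F

end K3

/-! ### Kac's ten-dimensional superalgebra -/

/-- `K10 F = F 1 ⊕ (K3 ⊗ K3)`: the pair `(α, s)` stands for `α 1 + s`. -/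
abbrev K10 (F : Type w) [Field F] : Type w := F × (K3 F ⊗[F] K3 F)

namespace K10

/-- The unity. -/
def one : K10 F := (1, 0)

/-- The element `x ⊗ y`. -/
def tmul {F : Type w} [Field F] (x y : K3 F) : K10 F := (0, x ⊗ₜ[F] y)

/-- The bilinear map with `(x ⊗ y, z ⊗ t) ↦ (-1)^{|y||z|} x z ⊗ y t` for homogeneous elements.
The even part of `z` contributes no sign, and its odd part contributes the sign `(-1)^{|y|}`. -/
def mulTensor : K3 F ⊗[F] K3 F →ₗ[F] K3 F ⊗[F] K3 F →ₗ[F] K3 F ⊗[F] K3 F :=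
  TensorProduct.map₂ ((K3.mul F).compl₂ (K3.evenProj F)) (K3.mul F) +
    TensorProduct.map₂ ((K3.mul F).compl₂ (K3.oddProj F)) (K3.mul F ∘ₗ K3.parity F)

/-- The bilinear form with `(x ⊗ y, z ⊗ t) ↦ (-1)^{|y||z|} (x | z) (y | t)` for homogeneous
elements. -/
def formTensor : K3 F ⊗[F] K3 F →ₗ[F] K3 F ⊗[F] K3 F →ₗ[F] F :=
  (TensorProduct.map₂ ((K3.form F).compl₂ (K3.evenProj F)) (K3.form F) +
    TensorProduct.map₂ ((K3.form F).compl₂ (K3.oddProj F)) (K3.form F ∘ₗ K3.parity F)).compr₂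
      (TensorProduct.lid F F).toLinearMap

/-- The product of `K10`: `1` is the unity, and
`(x ⊗ y) (z ⊗ t) = (-1)^{|y||z|} (x z ⊗ y t - (3/4) (x | z) (y | t) 1)`
for homogeneous `x, y, z, t` in `K3`. -/
def mul : K10 F →ₗ[F] K10 F →ₗ[F] K10 F :=
  LinearMap.mk₂ F
    (fun X Y => (X.1 * Y.1 - (3 / 4 : F) * formTensor F X.2 Y.2,
      X.1 • Y.2 + Y.1 • X.2 + mulTensor F X.2 Y.2))
    (by intro X X' Y; ext
        · simp; ring
        · simp [add_smul]; abel)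
    (by intro c X Y; ext
        · simp; ring
        · simp [mul_smul, smul_comm c])
    (by intro X Y Y'; ext
        · simp; ring
        · simp [add_smul]; abel)
    (by intro c X Y; ext
        · simp; ring
        · simp [mul_smul, smul_comm c])

theorem mul_tmul_tmul_of_left_even (x z t : K3 F) (r : F) :
    mul F (tmul x (r, 0)) (tmul z t) =
      tmul (K3.mul F x z) (K3.mul F (r, 0) t)
        - ((3 / 4 : F) * (K3.form F x z * K3.form F (r, 0) t)) • one F := by
  have hz : z = K3.evenProj F z + K3.oddProj F z := by ext <;> simp [K3.evenProj, K3.oddProj]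
  have hp : K3.parity F (r, 0) = (r, 0) := by
    ext <;> simp [K3.parity, K3.evenProj, K3.oddProj]
  ext
  · conv_rhs => rw [hz]
    simp [mul, tmul, one, formTensor, hp, -mul_eq_mul_left_iff]; ring
  · conv_rhs => rw [hz]
    simp [mul, tmul, one, mulTensor, hp, TensorProduct.add_tmul]

theorem mul_tmul_tmul_of_right_even (x y t : K3 F) (r : F) :
    mul F (tmul x y) (tmul (r, 0) t) =
      tmul (K3.mul F x (r, 0)) (K3.mul F y t)
        - ((3 / 4 : F) * (K3.form F x (r, 0) * K3.form F y t)) • one F := by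
  have h0 : K3.evenProj F (r, 0) = (r, 0) := by ext <;> simp [K3.evenProj]
  have h1 : K3.oddProj F (r, 0) = 0 := by ext <;> simp [K3.oddProj]
  ext <;> simp [mul, tmul, one, formTensor, mulTensor, h0, h1]

theorem mul_tmul_tmul_of_odd_odd (x t : K3 F) (y z : Fin 2 → F) :
    mul F (tmul x (K3.odd y)) (tmul (K3.odd z) t) =
      -(tmul (K3.mul F x (K3.odd z)) (K3.mul F (K3.odd y) t)
        - ((3 / 4 : F) * (K3.form F x (K3.odd z) * K3.form F (K3.odd y) t)) • one F) := by
  have h0 : K3.evenProj F (K3.odd z) = 0 := by ext <;> simp [K3.evenProj, K3.odd]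
  have h1 : K3.oddProj F (K3.odd z) = K3.odd z := by ext <;> simp [K3.oddProj, K3.odd]
  have hp : K3.parity F (K3.odd y) = -K3.odd y := by
    ext <;> simp [K3.parity, K3.evenProj, K3.oddProj, K3.odd]
  ext <;> simp [mul, tmul, one, formTensor, mulTensor, h0, h1, hp, TensorProduct.tmul_neg]

/-- The even part `F 1 ⊕ F (a ⊗ a) ⊕ (W ⊗ W)`. -/
def evenPart : Submodule F (K10 F) :=
  Submodule.span F ({one F, tmul (K3.a F) (K3.a F)} ∪
    {z | ∃ x y : Fin 2 → F, z = tmul (K3.odd x) (K3.odd y)})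

/-- The odd part `(W ⊗ a) ⊕ (a ⊗ W)`. -/
def oddPart : Submodule F (K10 F) :=
  Submodule.span F ({z | ∃ x : Fin 2 → F, z = tmul (K3.odd x) (K3.a F)} ∪
    {z | ∃ x : Fin 2 → F, z = tmul (K3.a F) (K3.odd x)})

/-- Automorphisms of the superalgebra: linear bijections that preserve the product and the
parity. -/
def IsAut {F : Type w} [Field F] (φ : K10 F ≃ₗ[F] K10 F) : Prop :=
  (∀ X Y, φ (mul F X Y) = mul F (φ X) (φ Y)) ∧
    (evenPart F).map φ.toLinearMap = evenPart F ∧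
    (oddPart F).map φ.toLinearMap = oddPart F

end K10

/-! ### Gradings on `K10` by abelian groups -/

/-- A `G`-grading on the superalgebra `K10`: a direct sum decomposition into subspaces indexed by
`G` with `A_g A_h ⊆ A_{gh}` and `A_g = (A_g ∩ A_even) ⊕ (A_g ∩ A_odd)`. -/
@[ext]
structure Grading (F : Type w) [Field F] (G : Type u) [CommGroup G] where
  comp : G → Submodule F (K10 F)
  independent : iSupIndep comp
  iSup_eq_top : ⨆ g, comp g = ⊤
  mul_mem : ∀ g h : G, ∀ X ∈ comp g, ∀ Y ∈ comp h, K10.mul F X Y ∈ comp (g * h)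
  super : ∀ g : G, comp g = (comp g ⊓ K10.evenPart F) ⊔ (comp g ⊓ K10.oddPart F)

namespace Grading

variable {F} {G : Type u} [CommGroup G] {H : Type v} [CommGroup H]

/-- The support: degrees of the nonzero homogeneous components. -/
def support (Γ : Grading F G) : Set G := {g | Γ.comp g ≠ ⊥}

/-- Isomorphism of two gradings by the same group. -/
def Iso (Γ Γ' : Grading F G) : Prop :=
  ∃ φ : K10 F ≃ₗ[F] K10 F, K10.IsAut φ ∧
    ∀ g, (Γ.comp g).map φ.toLinearMap = Γ'.comp g

/-- Equivalence of two gradings, by possibly different groups: some automorphism carries the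
nonzero homogeneous components of one to those of the other. -/
def Equivalent (Γ : Grading F G) (Γ' : Grading F H) : Prop :=
  ∃ φ : K10 F ≃ₗ[F] K10 F, K10.IsAut φ ∧
    ∀ g ∈ Γ.support, ∃ h ∈ Γ'.support, (Γ.comp g).map φ.toLinearMap = Γ'.comp h

/-- `Γ'` is a proper refinement of `Γ`: every component of `Γ'` lies in a component of `Γ`, and for
at least one nonzero component the inclusion is strict. -/
def IsProperRefinement (Γ' : Grading F H) (Γ : Grading F G) : Prop :=
  (∀ h, ∃ g, Γ'.comp h ≤ Γ.comp g) ∧ ∃ h ∈ Γ'.support, ∃ g, Γ'.comp h < Γ.comp g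

/-- `Γ¹(G; g₁, g₂)`: the grading is the one determined by
`deg (u ⊗ a) = g₁ = deg (v ⊗ a)⁻¹` and `deg (a ⊗ u) = g₂ = deg (a ⊗ v)⁻¹`. -/
def IsGamma1 (Γ : Grading F G) (g₁ g₂ : G) : Prop :=
  K10.tmul (K3.u F) (K3.a F) ∈ Γ.comp g₁ ∧
  K10.tmul (K3.v F) (K3.a F) ∈ Γ.comp g₁⁻¹ ∧
  K10.tmul (K3.a F) (K3.u F) ∈ Γ.comp g₂ ∧
  K10.tmul (K3.a F) (K3.v F) ∈ Γ.comp g₂⁻¹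

/-- `Γ²(G; g, h)`: the grading is the one determined by
`deg (u ⊗ a + a ⊗ u) = g = deg (v ⊗ a + a ⊗ v)⁻¹` and
`deg (u ⊗ a - a ⊗ u) = g h = deg (v ⊗ a - a ⊗ v)⁻¹`. -/
def IsGamma2 (Γ : Grading F G) (g h : G) : Prop :=
  K10.tmul (K3.u F) (K3.a F) + K10.tmul (K3.a F) (K3.u F) ∈ Γ.comp g ∧
  K10.tmul (K3.v F) (K3.a F) + K10.tmul (K3.a F) (K3.v F) ∈ Γ.comp g⁻¹ ∧
  K10.tmul (K3.u F) (K3.a F) - K10.tmul (K3.a F) (K3.u F) ∈ Γ.comp (g * h) ∧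
  K10.tmul (K3.v F) (K3.a F) - K10.tmul (K3.a F) (K3.v F) ∈ Γ.comp (g * h)⁻¹

end Grading

/-- A grading is fine if it has no proper refinement among the gradings by abelian groups (taken
in an arbitrary universe `v`). -/
def Grading.IsFine.{v', u', w'} {F : Type w'} [Field F] {G : Type u'} [CommGroup G]
    (Γ : Grading F G) : Prop :=
  ∀ (H : Type v') [CommGroup H] (Γ' : Grading F H), ¬ Γ'.IsProperRefinement Γ

end Kac

end

/-!
The products of odd elements span, together with `1`, the even part of `K10`, so a grading is
determined by its odd components. On the odd part `m, n ↦ trace (p ↦ (m n) p)` is a multiple of the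
skew-symmetric form `(m | n)`, hence that form is homogeneous for every grading. The triple product
and the form in turn recover the involution `oddFlip` that is `1` on `W ⊗ a` and `-1` on `a ⊗ W`,
up to sign. Therefore `oddFlip` is homogeneous of some degree `h` with `h² = e`, and `h` is an
invariant of the grading. If `h = e`, then `W ⊗ a` and `a ⊗ W` are graded subspaces, and homogeneous
symplectic bases of them identify the grading with some `Γ¹(G; g₁, g₂)`. If `h ≠ e`, a homogeneous
odd `m`, its flip and their duals for the form give a symplectic basis of homogeneous elements that
identifies the grading with some `Γ²(G; g, h)`. All these gradings are coarsenings of two universal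
ones, and the second universal grading splits `Γ¹(ℤ; 1, 1)` into the eigenspaces of the exchange of
the tensor factors.
-/

noncomputable section

namespace Kac

section HomogeneousFamilies

variable {R : Type*} [CommRing R] {V : Type*} [AddCommGroup V] [Module R V] {D : Type*}
  {A : D → Submodule R V}

theorem eq_zero_of_mem_of_mem_iSup_ne (hA : iSupIndep A) {i : D} {x : V} (hi : x ∈ A i)
    (h : x ∈ ⨆ (j) (_ : j ≠ i), A j) : x = 0 :=
  Submodule.disjoint_def.1 (hA i) x hi h

theorem eq_zero_of_mem_of_mem (hA : iSupIndep A) {i j : D} (hij : i ≠ j) {x : V} (hi : x ∈ A i)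
    (hj : x ∈ A j) : x = 0 :=
  Submodule.disjoint_def.1 (hA.pairwiseDisjoint hij) x hi hj

theorem exists_add_of_iSup_eq_top (hA : ⨆ i, A i = ⊤) (i : D) (x : V) :
    ∃ y ∈ A i, ∃ z ∈ ⨆ (j) (_ : j ≠ i), A j, y + z = x := by
  refine Submodule.mem_sup.1 ?_
  rw [← iSup_split_single, hA]
  trivial

variable {ι : Type*} (b : Module.Basis ι R V) (d : ι → D)

/-- The vectors of degree `g` when each basis vector `b i` is given the degree `d i`. -/
def homogeneousSpan (g : D) : Submodule R V := Submodule.span R (b '' (d ⁻¹' {g}))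

variable {b d}

theorem basis_mem_homogeneousSpan (i : ι) : b i ∈ homogeneousSpan b d (d i) :=
  Submodule.subset_span ⟨i, rfl, rfl⟩

theorem homogeneousSpan_le {g : D} {S : Submodule R V} :
    homogeneousSpan b d g ≤ S ↔ ∀ i, d i = g → b i ∈ S := by
  simp [homogeneousSpan, Submodule.span_le, Set.subset_def]

theorem apply_mem_of_mem_homogeneousSpan {V' W : Type*} [AddCommGroup V'] [Module R V']
    [AddCommGroup W] [Module R W] {D' ι' : Type*} {b' : Module.Basis ι' R V'} {d' : ι' → D'}
    {f : V →ₗ[R] V' →ₗ[R] W} {S : Submodule R W} {g : D} {h : D'}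
    (hf : ∀ i j, d i = g → d' j = h → f (b i) (b' j) ∈ S) {x : V} {y : V'}
    (hx : x ∈ homogeneousSpan b d g) (hy : y ∈ homogeneousSpan b' d' h) : f x y ∈ S := by
  have hfx : homogeneousSpan b' d' h ≤ S.comap (f x) := homogeneousSpan_le.2 fun j hj => by
    have hfj : homogeneousSpan b d g ≤ S.comap (f.flip (b' j)) :=
      homogeneousSpan_le.2 fun i hi => hf i j hi hj
    exact hfj hx
  exact hfx hy

theorem iSup_homogeneousSpan : ⨆ g, homogeneousSpan b d g = ⊤ := by
  refine top_le_iff.1 (b.span_eq.symm.le.trans (Submodule.span_le.2 ?_))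
  rintro _ ⟨i, rfl⟩
  exact Submodule.mem_iSup_of_mem (d i) (basis_mem_homogeneousSpan i)

theorem iSupIndep_homogeneousSpan [Nontrivial R] : iSupIndep (homogeneousSpan b d) := by
  intro g
  have hdisj : Disjoint (d ⁻¹' {g}) (d ⁻¹' {g}ᶜ) := Set.disjoint_left.2 fun _ h h' => h' h
  refine (b.linearIndependent.disjoint_span_image hdisj).mono_right ?_
  exact iSup₂_le fun g' hg' => homogeneousSpan_le.2 fun i hi =>
    Submodule.subset_span ⟨i, by simp [hi, hg'], rfl⟩

theorem eq_homogeneousSpan (hA : iSupIndep A) (h : ∀ i, b i ∈ A (d i)) :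
    A = homogeneousSpan b d :=
  ((hA.le_iff_eq_of_iSup_eq_top iSup_homogeneousSpan).1 fun _ =>
    homogeneousSpan_le.2 fun i hi => hi ▸ h i).symm

theorem homogeneousSpan_eq_span_singleton (hd : Function.Injective d) (i : ι) :
    homogeneousSpan b d (d i) = R ∙ b i := by
  rw [homogeneousSpan, ← Set.image_singleton, hd.preimage_image, Set.image_singleton]

theorem homogeneousSpan_ne_bot [Nontrivial R] {g : D} :
    homogeneousSpan b d g ≠ ⊥ ↔ g ∈ Set.range d := by
  simp [homogeneousSpan, Submodule.span_eq_bot, b.ne_zero]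

end HomogeneousFamilies

variable {F : Type w} [Field F]

section K10Product

namespace K3

@[simp] theorem mul_a_a : mul F (a F) (a F) = a F := by ext <;> simp [mul, a, skew]

@[simp] theorem mul_a_odd (x : Fin 2 → F) : mul F (a F) (odd x) = (2⁻¹ : F) • odd x := by
  ext <;> simp [mul, a, odd, skew]

@[simp] theorem mul_odd_a (x : Fin 2 → F) : mul F (odd x) (a F) = (2⁻¹ : F) • odd x := by
  ext <;> simp [mul, a, odd, skew]

@[simp] theorem mul_odd_odd (x y : Fin 2 → F) : mul F (odd x) (odd y) = skew x y • a F := by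
  ext <;> simp [mul, a, odd]

@[simp] theorem form_a_a : form F (a F) (a F) = 2⁻¹ := by simp [form, a, skew]

@[simp] theorem form_a_odd (x : Fin 2 → F) : form F (a F) (odd x) = 0 := by
  simp [form, a, odd, skew]

@[simp] theorem form_odd_a (x : Fin 2 → F) : form F (odd x) (a F) = 0 := by
  simp [form, a, odd, skew]

@[simp] theorem form_odd_odd (x y : Fin 2 → F) : form F (odd x) (odd y) = skew x y := by
  simp [form, odd]

@[simp] theorem evenProj_a : evenProj F (a F) = a F := by ext <;> simp [evenProj, a]

@[simp] theorem evenProj_odd (x : Fin 2 → F) : evenProj F (odd x) = 0 := by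
  ext <;> simp [evenProj, odd]

@[simp] theorem oddProj_a : oddProj F (a F) = 0 := by ext <;> simp [oddProj, a]

@[simp] theorem oddProj_odd (x : Fin 2 → F) : oddProj F (odd x) = odd x := by
  ext <;> simp [oddProj, odd]

@[simp] theorem parity_a : parity F (a F) = a F := by simp [parity]

@[simp] theorem parity_odd (x : Fin 2 → F) : parity F (odd x) = -odd x := by simp [parity]

end K3

namespace K10

open K3 (a odd skew)

theorem tmul_smul (c : F) (x y : K3 F) : tmul x (c • y) = c • tmul x y := by
  ext <;> simp [tmul]

theorem smul_tmul (c : F) (x y : K3 F) : tmul (c • x) y = c • tmul x y := by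
  ext <;> simp [tmul, TensorProduct.smul_tmul']

@[simp] theorem unit_mul (X : K10 F) : mul F (one F) X = X := by ext <;> simp [mul, one]

@[simp] theorem mul_unit (X : K10 F) : mul F X (one F) = X := by ext <;> simp [mul, one]

theorem mul_tmul_a (x z t : K3 F) : mul F (tmul x (a F)) (tmul z t) =
    tmul (K3.mul F x z) (K3.mul F (a F) t) -
      ((3 / 4 : F) * (K3.form F x z * K3.form F (a F) t)) • one F :=
  mul_tmul_tmul_of_left_even F x z t 1

theorem mul_a_tmul (x y t : K3 F) : mul F (tmul x y) (tmul (a F) t) =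
    tmul (K3.mul F x (a F)) (K3.mul F y t) -
      ((3 / 4 : F) * (K3.form F x (a F) * K3.form F y t)) • one F :=
  mul_tmul_tmul_of_right_even F x y t 1

@[simp] theorem mul_aa_aa : mul F (tmul (a F) (a F)) (tmul (a F) (a F)) =
    tmul (a F) (a F) - (3 / 4 * (2⁻¹ * 2⁻¹) : F) • one F := by
  rw [mul_tmul_a, K3.mul_a_a, K3.form_a_a]

@[simp] theorem mul_aa_ww (x y : Fin 2 → F) :
    mul F (tmul (a F) (a F)) (tmul (odd x) (odd y)) =
      (2⁻¹ * 2⁻¹ : F) • tmul (odd x) (odd y) := by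
  simp [mul_tmul_a, smul_tmul, tmul_smul, smul_smul]

@[simp] theorem mul_ww_aa (x y : Fin 2 → F) :
    mul F (tmul (odd x) (odd y)) (tmul (a F) (a F)) =
      (2⁻¹ * 2⁻¹ : F) • tmul (odd x) (odd y) := by
  simp [mul_a_tmul, smul_tmul, tmul_smul, smul_smul]

@[simp] theorem mul_ww_ww (x y z t : Fin 2 → F) :
    mul F (tmul (odd x) (odd y)) (tmul (odd z) (odd t)) =
      -(skew x z * skew y t) • (tmul (a F) (a F) - (3 / 4 : F) • one F) := by
  rw [mul_tmul_tmul_of_odd_odd]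
  simp only [K3.mul_odd_odd, K3.form_odd_odd, smul_tmul, tmul_smul]
  module

@[simp] theorem mul_aa_wa (x : Fin 2 → F) :
    mul F (tmul (a F) (a F)) (tmul (odd x) (a F)) =
      (2⁻¹ : F) • tmul (odd x) (a F) := by
  simp [mul_tmul_a, smul_tmul]

@[simp] theorem mul_wa_aa (x : Fin 2 → F) :
    mul F (tmul (odd x) (a F)) (tmul (a F) (a F)) =
      (2⁻¹ : F) • tmul (odd x) (a F) := by
  simp [mul_tmul_a, smul_tmul]

@[simp] theorem mul_aa_aw (y : Fin 2 → F) :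
    mul F (tmul (a F) (a F)) (tmul (a F) (odd y)) =
      (2⁻¹ : F) • tmul (a F) (odd y) := by
  simp [mul_tmul_a, tmul_smul]

@[simp] theorem mul_aw_aa (y : Fin 2 → F) :
    mul F (tmul (a F) (odd y)) (tmul (a F) (a F)) =
      (2⁻¹ : F) • tmul (a F) (odd y) := by
  simp [mul_a_tmul, tmul_smul]

@[simp] theorem mul_wa_wa (x z : Fin 2 → F) :
    mul F (tmul (odd x) (a F)) (tmul (odd z) (a F)) =
      skew x z • (tmul (a F) (a F) - (3 / 4 * 2⁻¹ : F) • one F) := by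
  rw [mul_tmul_a]
  simp only [K3.mul_odd_odd, K3.mul_a_a, K3.form_odd_odd, K3.form_a_a, smul_tmul]
  module

@[simp] theorem mul_aw_aw (y t : Fin 2 → F) :
    mul F (tmul (a F) (odd y)) (tmul (a F) (odd t)) =
      skew y t • (tmul (a F) (a F) - (3 / 4 * 2⁻¹ : F) • one F) := by
  rw [mul_a_tmul]
  simp only [K3.mul_odd_odd, K3.mul_a_a, K3.form_odd_odd, K3.form_a_a, tmul_smul]
  module

@[simp] theorem mul_wa_aw (x t : Fin 2 → F) :
    mul F (tmul (odd x) (a F)) (tmul (a F) (odd t)) =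
      (2⁻¹ * 2⁻¹ : F) • tmul (odd x) (odd t) := by
  simp [mul_tmul_a, smul_tmul, tmul_smul, smul_smul]

@[simp] theorem mul_aw_wa (y z : Fin 2 → F) :
    mul F (tmul (a F) (odd y)) (tmul (odd z) (a F)) =
      -((2⁻¹ * 2⁻¹ : F) • tmul (odd z) (odd y)) := by
  simp [mul_tmul_tmul_of_odd_odd, smul_tmul, tmul_smul, smul_smul]

@[simp] theorem mul_ww_wa (x y z : Fin 2 → F) :
    mul F (tmul (odd x) (odd y)) (tmul (odd z) (a F)) =
      -((2⁻¹ * skew x z) • tmul (a F) (odd y)) := by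
  simp [mul_tmul_tmul_of_odd_odd, smul_tmul, tmul_smul, smul_smul]

@[simp] theorem mul_wa_ww (x y z : Fin 2 → F) :
    mul F (tmul (odd z) (a F)) (tmul (odd x) (odd y)) =
      (2⁻¹ * skew z x) • tmul (a F) (odd y) := by
  simp [mul_tmul_a, smul_tmul, tmul_smul, smul_smul]

@[simp] theorem mul_ww_aw (x y t : Fin 2 → F) :
    mul F (tmul (odd x) (odd y)) (tmul (a F) (odd t)) =
      (2⁻¹ * skew y t) • tmul (odd x) (a F) := by
  simp [mul_a_tmul, smul_tmul, tmul_smul, smul_smul, mul_comm]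

@[simp] theorem mul_aw_ww (x y t : Fin 2 → F) :
    mul F (tmul (a F) (odd t)) (tmul (odd x) (odd y)) =
      -((2⁻¹ * skew t y) • tmul (odd x) (a F)) := by
  simp [mul_tmul_tmul_of_odd_odd, smul_tmul, tmul_smul, smul_smul, mul_comm]

theorem hom_ext {M : Type*} [AddCommMonoid M] [Module F M] {f g : K10 F →ₗ[F] M}
    (h1 : f (one F) = g (one F)) (haa : f (tmul (a F) (a F)) = g (tmul (a F) (a F)))
    (hww : ∀ x y, f (tmul (odd x) (odd y)) = g (tmul (odd x) (odd y)))
    (hwa : ∀ x, f (tmul (odd x) (a F)) = g (tmul (odd x) (a F)))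
    (haw : ∀ y, f (tmul (a F) (odd y)) = g (tmul (a F) (odd y))) : f = g := by
  refine LinearMap.prod_ext (LinearMap.ext_ring h1) (TensorProduct.ext ?_)
  refine LinearMap.prod_ext (LinearMap.ext_ring ?_) (LinearMap.ext fun x => ?_) <;>
    refine LinearMap.prod_ext (LinearMap.ext_ring ?_) (LinearMap.ext fun y => ?_)
  exacts [haa, haw y, hwa x, hww x y]

end K10

end K10Product

section Automorphisms

namespace K10

open K3 (a odd skew)

theorem isAut_of_le {φ : K10 F ≃ₗ[F] K10 F} (hmul : ∀ X Y, φ (mul F X Y) = mul F (φ X) (φ Y))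
    (heven : evenPart F ≤ (evenPart F).comap φ.toLinearMap)
    (hodd : oddPart F ≤ (oddPart F).comap φ.toLinearMap) : IsAut φ := by
  refine ⟨hmul, ?_, ?_⟩ <;>
    refine Submodule.eq_of_le_of_finrank_eq ?_ (LinearEquiv.finrank_map_eq φ _)
  · exact Submodule.map_le_iff_le_comap.2 heven
  · exact Submodule.map_le_iff_le_comap.2 hodd

theorem IsAut.apply_mem_evenPart {φ : K10 F ≃ₗ[F] K10 F} (h : IsAut φ) {X : K10 F}
    (hX : X ∈ evenPart F) : φ X ∈ evenPart F :=
  h.2.1 ▸ Submodule.mem_map_of_mem hX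

theorem IsAut.apply_mem_oddPart {φ : K10 F ≃ₗ[F] K10 F} (h : IsAut φ) {X : K10 F}
    (hX : X ∈ oddPart F) : φ X ∈ oddPart F :=
  h.2.2 ▸ Submodule.mem_map_of_mem hX

theorem IsAut.refl : IsAut (LinearEquiv.refl F (K10 F)) :=
  isAut_of_le (fun _ _ => rfl) (fun _ h => h) (fun _ h => h)

theorem IsAut.trans {φ ψ : K10 F ≃ₗ[F] K10 F} (h : IsAut φ) (h' : IsAut ψ) :
    IsAut (φ.trans ψ) :=
  isAut_of_le (fun X Y => by simp [h.1, h'.1])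
    (fun _ hX => h'.apply_mem_evenPart (h.apply_mem_evenPart hX))
    (fun _ hX => h'.apply_mem_oddPart (h.apply_mem_oddPart hX))

theorem IsAut.symm {φ : K10 F ≃ₗ[F] K10 F} (h : IsAut φ) : IsAut φ.symm := by
  refine isAut_of_le (fun X Y => φ.injective (by simp [h.1])) (fun X hX => ?_) (fun X hX => ?_)
  · obtain ⟨Y, hY, rfl⟩ := h.2.1 ▸ hX
    simpa using hY
  · obtain ⟨Y, hY, rfl⟩ := h.2.2 ▸ hX
    simpa using hY

/-- The linear automorphism of `K10` that fixes `1` and `a ⊗ a` and acts by `A` and `B` on the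
odd part of the first and of the second tensor factor. -/
def tensorEquiv (A B : (Fin 2 → F) ≃ₗ[F] (Fin 2 → F)) : K10 F ≃ₗ[F] K10 F :=
  (LinearEquiv.refl F F).prodCongr (TensorProduct.congr
    ((LinearEquiv.refl F F).prodCongr A) ((LinearEquiv.refl F F).prodCongr B))

@[simp] theorem tensorEquiv_one (A B : (Fin 2 → F) ≃ₗ[F] (Fin 2 → F)) :
    tensorEquiv A B (one F) = one F := by
  ext <;> simp [tensorEquiv, one]

theorem tensorEquiv_tmul (A B : (Fin 2 → F) ≃ₗ[F] (Fin 2 → F)) (x y : K3 F) :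
    tensorEquiv A B (tmul x y) = tmul (x.1, A x.2) (y.1, B y.2) := by
  ext <;> simp [tensorEquiv, tmul]

@[simp] theorem tensorEquiv_aa (A B : (Fin 2 → F) ≃ₗ[F] (Fin 2 → F)) :
    tensorEquiv A B (tmul (a F) (a F)) = tmul (a F) (a F) := by
  simp [tensorEquiv_tmul, a]

@[simp] theorem tensorEquiv_ww (A B : (Fin 2 → F) ≃ₗ[F] (Fin 2 → F)) (x y : Fin 2 → F) :
    tensorEquiv A B (tmul (odd x) (odd y)) = tmul (odd (A x)) (odd (B y)) := by
  simp [tensorEquiv_tmul, odd]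

@[simp] theorem tensorEquiv_wa (A B : (Fin 2 → F) ≃ₗ[F] (Fin 2 → F)) (x : Fin 2 → F) :
    tensorEquiv A B (tmul (odd x) (a F)) = tmul (odd (A x)) (a F) := by
  simp [tensorEquiv_tmul, odd, a]

@[simp] theorem tensorEquiv_aw (A B : (Fin 2 → F) ≃ₗ[F] (Fin 2 → F)) (y : Fin 2 → F) :
    tensorEquiv A B (tmul (a F) (odd y)) = tmul (a F) (odd (B y)) := by
  simp [tensorEquiv_tmul, odd, a]

/-- The linear map `1 ↦ 1`, `x ⊗ y ↦ (-1)^{|x||y|} y ⊗ x` for homogeneous `x` and `y`. -/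
def swapHom (F : Type w) [Field F] : K10 F →ₗ[F] K10 F :=
  LinearMap.id.prodMap ((TensorProduct.comm F (K3 F) (K3 F)).toLinearMap ∘ₗ
    (TensorProduct.map LinearMap.id (K3.evenProj F) +
      TensorProduct.map (K3.parity F) (K3.oddProj F)))

@[simp] theorem swapHom_one : swapHom F (one F) = one F := by
  ext <;> simp [swapHom, one]

@[simp] theorem swapHom_a (x : K3 F) : swapHom F (tmul x (a F)) = tmul (a F) x := by
  ext <;> simp [swapHom, tmul]

@[simp] theorem swapHom_aw (y : Fin 2 → F) :
    swapHom F (tmul (a F) (odd y)) = tmul (odd y) (a F) := by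
  ext <;> simp [swapHom, tmul]

@[simp] theorem swapHom_ww (x y : Fin 2 → F) :
    swapHom F (tmul (odd x) (odd y)) = -tmul (odd y) (odd x) := by
  ext <;> simp [swapHom, tmul, TensorProduct.tmul_neg]

theorem swapHom_swapHom (X : K10 F) : swapHom F (swapHom F X) = X := by
  suffices swapHom F ∘ₗ swapHom F = LinearMap.id from LinearMap.congr_fun this X
  apply hom_ext <;> intros <;> simp

/-- The exchange automorphism `x ⊗ y ↦ (-1)^{|x||y|} y ⊗ x` of `K10`. -/
def swap (F : Type w) [Field F] : K10 F ≃ₗ[F] K10 F :=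
  LinearEquiv.ofInvolutive (swapHom F) swapHom_swapHom

theorem map_mul_of_linearMap_ext {φ : K10 F →ₗ[F] K10 F}
    (h : (mul F).compr₂ φ = (mul F).compl₁₂ φ φ) (X Y : K10 F) :
    φ (mul F X Y) = mul F (φ X) (φ Y) := LinearMap.congr_fun₂ h X Y

theorem swapHom_mul (X Y : K10 F) : swapHom F (mul F X Y) = mul F (swapHom F X) (swapHom F Y) := by
  refine map_mul_of_linearMap_ext ?_ X Y
  apply hom_ext <;> intros <;> apply hom_ext <;> intros <;>
    simp [mul_comm]

theorem tensorEquiv_mul {A B : (Fin 2 → F) ≃ₗ[F] (Fin 2 → F)}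
    (hA : ∀ x y, skew (A x) (A y) = skew x y) (hB : ∀ x y, skew (B x) (B y) = skew x y)
    (X Y : K10 F) :
    tensorEquiv A B (mul F X Y) = mul F (tensorEquiv A B X) (tensorEquiv A B Y) := by
  refine map_mul_of_linearMap_ext (φ := (tensorEquiv A B).toLinearMap) ?_ X Y
  apply hom_ext <;> intros <;> apply hom_ext <;> intros <;>
    simp [hA, hB]

end K10

end Automorphisms

section OddPart

/-- The odd part `(W ⊗ a) ⊕ (a ⊗ W)` of `K10` as a pair of copies of `W = F²`; the pair `(x, y)`
stands for `x ⊗ a + a ⊗ y`. -/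
abbrev OddVec (F : Type w) [Field F] : Type w := (Fin 2 → F) × (Fin 2 → F)

/-- The nondegenerate skew-symmetric form on the odd part that restricts to `(· | ·)` on both
copies of `W`. -/
def oddForm : OddVec F →ₗ[F] OddVec F →ₗ[F] F :=
  LinearMap.mk₂ F (fun m n => K3.skew m.1 n.1 + K3.skew m.2 n.2)
    (by intros; simp only [K3.skew, Prod.fst_add, Prod.snd_add, Pi.add_apply]; ring)
    (by intros; simp only [K3.skew, Prod.smul_fst, Prod.smul_snd, Pi.smul_apply, smul_eq_mul]; ring)
    (by intros; simp only [K3.skew, Prod.fst_add, Prod.snd_add, Pi.add_apply]; ring)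
    (by intros; simp only [K3.skew, Prod.smul_fst, Prod.smul_snd, Pi.smul_apply, smul_eq_mul]; ring)

theorem oddForm_apply (m n : OddVec F) : oddForm m n = K3.skew m.1 n.1 + K3.skew m.2 n.2 := rfl

/-- The involution of the odd part that fixes `W ⊗ a` and changes the sign on `a ⊗ W`. -/
def oddFlip : OddVec F →ₗ[F] OddVec F := LinearMap.id.prodMap (-LinearMap.id)

theorem oddFlip_apply (m : OddVec F) : oddFlip m = (m.1, -m.2) := rfl

/-- Eight times the triple product `(m n) p` of odd elements, as a linear map in `p`. -/
def oddTriple (m n : OddVec F) : OddVec F →ₗ[F] OddVec F where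
  toFun p := oddForm m n • p +
    (K3.skew n.2 p.2 • m.1 - K3.skew m.2 p.2 • n.1, K3.skew n.1 p.1 • m.2 - K3.skew m.1 p.1 • n.2)
  map_add' p q := by
    ext <;> simp only [K3.skew, Prod.fst_add, Prod.snd_add, Pi.add_apply, Pi.sub_apply,
      Prod.smul_fst, Prod.smul_snd, Pi.smul_apply, smul_eq_mul] <;> ring
  map_smul' c p := by
    ext <;> simp only [K3.skew, Prod.fst_add, Prod.snd_add, Pi.add_apply, Pi.sub_apply,
      Prod.smul_fst, Prod.smul_snd, Pi.smul_apply, smul_eq_mul, RingHom.id_apply] <;> ring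

theorem oddTriple_apply (m n p : OddVec F) : oddTriple m n p = oddForm m n • p +
    (K3.skew n.2 p.2 • m.1 - K3.skew m.2 p.2 • n.1,
      K3.skew n.1 p.1 • m.2 - K3.skew m.1 p.1 • n.2) := rfl

theorem trace_oddTriple (m n : OddVec F) :
    LinearMap.trace F (OddVec F) (oddTriple m n) = 4 * oddForm m n := by
  rw [LinearMap.trace_eq_matrix_trace F ((Pi.basisFun F (Fin 2)).prod (Pi.basisFun F (Fin 2)))]
  simp only [Matrix.trace, Matrix.diag_apply, LinearMap.toMatrix_apply, Module.Basis.prod_apply,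
    LinearMap.coe_inl, LinearMap.coe_inr, oddTriple_apply, K3.skew, map_add, map_smul,
    Finsupp.coe_add, Finsupp.coe_smul, Pi.add_apply, Pi.smul_apply, smul_eq_mul,
    Fintype.sum_sum_type, Sum.elim_inl, Sum.elim_inr, Function.comp_apply, Pi.basisFun_apply,
    Module.Basis.prod_repr_inl, Module.Basis.prod_repr_inr, Pi.basisFun_repr, Pi.single_eq_same,
    Pi.zero_apply, mul_zero, sub_self, zero_smul, map_zero, Finsupp.coe_zero, Finset.sum_const,
    Finset.card_univ, Fintype.card_fin, nsmul_eq_mul]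
  ring

theorem oddForm_swap (m n : OddVec F) : oddForm n m = -oddForm m n := by
  simp only [oddForm_apply, K3.skew]; ring

theorem oddForm_self (m : OddVec F) : oddForm m m = 0 := by
  simp only [oddForm_apply, K3.skew]; ring

theorem separatingLeft_oddForm : (oddForm (F := F)).SeparatingLeft := by
  intro m h
  have hm : m = (![oddForm m (![0, 1], 0), -oddForm m (![1, 0], 0)],
      ![oddForm m (0, ![0, 1]), -oddForm m (0, ![1, 0])]) := by
    ext i <;> fin_cases i <;> simp [oddForm_apply, K3.skew]
  rw [hm]
  ext i <;> fin_cases i <;> simp [h]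

theorem oddForm_oddFlip_smul_sub (m n p : OddVec F) :
    oddForm (oddFlip m) p • oddFlip n - oddForm (oddFlip n) p • oddFlip m
      = (2 : F) • oddTriple m n p - (2 * oddForm m n) • p - oddForm n p • m + oddForm m p • n := by
  simp only [oddTriple_apply, oddForm_apply, oddFlip_apply, K3.skew]
  ext i <;> fin_cases i <;> simp only [Prod.fst_add, Prod.fst_sub, Prod.smul_fst, Prod.snd_add,
    Prod.snd_sub, Prod.smul_snd, Prod.smul_mk, Pi.add_apply, Pi.sub_apply, Pi.neg_apply,
    Pi.smul_apply, smul_eq_mul, Fin.zero_eta, Fin.mk_one] <;> ring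

namespace K10

open K3 (a odd skew)

/-- The embedding of the odd part in `K10`. -/
def oddMap (F : Type w) [Field F] : OddVec F →ₗ[F] K10 F :=
  LinearMap.inr F F _ ∘ₗ
    LinearMap.coprod ((TensorProduct.mk F _ _).flip (a F) ∘ₗ LinearMap.inr F F _)
      (TensorProduct.mk F _ _ (a F) ∘ₗ LinearMap.inr F F _)

theorem oddMap_apply (m : OddVec F) :
    oddMap F m = tmul (odd m.1) (a F) + tmul (a F) (odd m.2) := by
  ext <;> simp [oddMap, tmul, odd]

theorem tmul_odd_a (x : Fin 2 → F) : tmul (odd x) (a F) = oddMap F (x, 0) := by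
  simp [oddMap, tmul, odd, ← Prod.zero_eq_mk]

theorem tmul_a_odd (y : Fin 2 → F) : tmul (a F) (odd y) = oddMap F (0, y) := by
  simp [oddMap, tmul, odd, ← Prod.zero_eq_mk]

theorem oddMap_injective : Function.Injective (oddMap F) := by
  have hleft : Function.LeftInverse
      (fun X : K10 F => ((TensorProduct.rid F (K3 F) (LinearMap.lTensor (K3 F)
          (LinearMap.fst F F (Fin 2 → F)) X.2)).2,
        (TensorProduct.lid F (K3 F) (LinearMap.rTensor (K3 F)
          (LinearMap.fst F F (Fin 2 → F)) X.2)).2)) (oddMap F) := by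
    intro m
    simp [oddMap, a]
  exact hleft.injective

theorem range_oddMap : LinearMap.range (oddMap F) = oddPart F := by
  refine le_antisymm ?_ (Submodule.span_le.2 ?_)
  · rintro _ ⟨m, rfl⟩
    rw [oddMap_apply]
    exact add_mem (Submodule.subset_span (Or.inl ⟨_, rfl⟩))
      (Submodule.subset_span (Or.inr ⟨_, rfl⟩))
  · rintro X (⟨x, rfl⟩ | ⟨x, rfl⟩)
    exacts [⟨_, (tmul_odd_a x).symm⟩, ⟨_, (tmul_a_odd x).symm⟩]

theorem oddMap_mem_oddPart (m : OddVec F) : oddMap F m ∈ oddPart F :=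
  range_oddMap (F := F) ▸ LinearMap.mem_range_self _ m

theorem disjoint_evenPart_oddPart (hF : (2 : F) ≠ 0) : Disjoint (evenPart F) (oddPart F) := by
  let parity : K10 F →ₗ[F] K10 F :=
    LinearMap.id.prodMap (TensorProduct.map (K3.parity F) (K3.parity F))
  have htmul (x y : K3 F) : parity (tmul x y) = tmul (K3.parity F x) (K3.parity F y) := by
    ext <;> simp [parity, tmul]
  have heven : Set.EqOn parity (LinearMap.id : K10 F →ₗ[F] K10 F) (evenPart F) := by
    refine LinearMap.eqOn_span ?_
    rintro X ((rfl | rfl) | ⟨x, y, rfl⟩)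
    · ext <;> simp [parity, one]
    · simp [htmul]
    · simp only [htmul, K3.parity_odd]
      ext <;> simp [tmul, TensorProduct.neg_tmul, TensorProduct.tmul_neg]
  have hodd : Set.EqOn parity (-LinearMap.id : K10 F →ₗ[F] K10 F) (oddPart F) := by
    refine LinearMap.eqOn_span ?_
    rintro X (⟨x, rfl⟩ | ⟨x, rfl⟩) <;> simp only [htmul, K3.parity_odd, K3.parity_a] <;>
      ext <;> simp [tmul, TensorProduct.neg_tmul, TensorProduct.tmul_neg]
  refine Submodule.disjoint_def.2 fun X h h' => ?_
  have hX : X = -X := (heven h).symm.trans (hodd h')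
  have h2 : (2 : F) • X = 0 := by rwa [two_smul, ← eq_neg_iff_add_eq_zero]
  exact (smul_eq_zero.1 h2).resolve_left hF

theorem mul_oddMap (m n : OddVec F) : mul F (oddMap F m) (oddMap F n) =
    oddForm m n • (tmul (a F) (a F) - (3 / 4 * 2⁻¹ : F) • one F) +
      (2⁻¹ * 2⁻¹ : F) • (tmul (odd m.1) (odd n.2) - tmul (odd n.1) (odd m.2)) := by
  simp only [oddMap_apply, map_add, LinearMap.add_apply, mul_wa_wa, mul_wa_aw, mul_aw_wa,
    mul_aw_aw, oddForm_apply]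
  module

theorem mul_mul_oddMap (hF : (2 : F) ≠ 0) (m n p : OddVec F) :
    (8 : F) • mul F (mul F (oddMap F m) (oddMap F n)) (oddMap F p) =
      oddMap F (oddTriple m n p) := by
  have h8 : (8 : F) = 2 * 2 * 2 := by norm_num
  have h4 : (4 : F) = 2 * 2 := by norm_num
  rw [mul_oddMap, oddMap_apply p]
  simp only [map_add, map_sub, map_smul, LinearMap.add_apply, LinearMap.sub_apply,
    LinearMap.smul_apply, unit_mul, mul_aa_wa, mul_aa_aw, mul_ww_wa, mul_ww_aw]
  simp only [tmul_odd_a, tmul_a_odd, ← map_smul, ← map_add, ← map_sub, ← map_neg,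
    oddTriple_apply, oddForm_apply, h8, h4]
  congr 1
  refine Prod.ext ?_ ?_ <;> simp only [Prod.fst_add, Prod.snd_add, Prod.fst_sub, Prod.snd_sub,
    Prod.smul_fst, Prod.smul_snd, Prod.fst_neg, Prod.snd_neg] <;>
    match_scalars <;> field_simp <;> ring

theorem tensorEquiv_oddMap (A B : (Fin 2 → F) ≃ₗ[F] (Fin 2 → F)) (m : OddVec F) :
    tensorEquiv A B (oddMap F m) = oddMap F (A m.1, B m.2) := by
  simp [oddMap_apply]

theorem tensorEquiv_isAut {A B : (Fin 2 → F) ≃ₗ[F] (Fin 2 → F)}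
    (hA : ∀ x y, skew (A x) (A y) = skew x y) (hB : ∀ x y, skew (B x) (B y) = skew x y) :
    IsAut (tensorEquiv A B) := by
  refine isAut_of_le (tensorEquiv_mul hA hB)
    (Submodule.span_le (p := Submodule.comap (tensorEquiv A B).toLinearMap _).2 ?_)
    (Submodule.span_le (p := Submodule.comap (tensorEquiv A B).toLinearMap _).2 ?_)
  · rintro X ((rfl | rfl) | ⟨y, z, rfl⟩) <;> refine Submodule.subset_span ?_
    · simp
    · simp
    · exact Or.inr ⟨A y, B z, tensorEquiv_ww A B y z⟩
  · rintro X (⟨x, rfl⟩ | ⟨x, rfl⟩) <;> refine Submodule.subset_span ?_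
    · exact Or.inl ⟨A x, tensorEquiv_wa A B x⟩
    · exact Or.inr ⟨B x, tensorEquiv_aw A B x⟩

theorem swap_oddMap (m : OddVec F) : swap F (oddMap F m) = oddMap F m.swap := by
  change swapHom F (oddMap F m) = _
  simp [oddMap_apply, add_comm]

theorem swap_isAut : IsAut (swap F) := by
  refine isAut_of_le swapHom_mul (Submodule.span_le (p := Submodule.comap (swapHom F) _).2 ?_)
    (Submodule.span_le (p := Submodule.comap (swapHom F) _).2 ?_)
  · rintro X ((rfl | rfl) | ⟨y, z, rfl⟩)
    · exact Submodule.subset_span (by simp)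
    · exact Submodule.subset_span (by simp)
    · have hmem : tmul (odd z) (odd y) ∈ evenPart F :=
        Submodule.subset_span (Or.inr ⟨z, y, rfl⟩)
      simpa using hmem
  · rintro X (⟨x, rfl⟩ | ⟨x, rfl⟩) <;> refine Submodule.subset_span ?_
    · exact Or.inr ⟨x, swapHom_a (odd x)⟩
    · exact Or.inl ⟨x, swapHom_aw x⟩

end K10

end OddPart

section OddComponents

namespace Grading

open K10

variable {G : Type u} [CommGroup G] (Γ : Grading F G)

theorem one_mem : one F ∈ Γ.comp 1 := by
  obtain ⟨X, hX, Y, hY, hXY⟩ := exists_add_of_iSup_eq_top Γ.iSup_eq_top 1 (one F)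
  -- Multiplication by `Y = 1 - X` maps `Γ.comp k` both into itself and into the sum of the other
  -- components.
  have hmul (k : G) : Γ.comp k ≤ LinearMap.ker (mul F Y) := by
    intro Z hZ
    have hk : mul F Y Z ∈ Γ.comp k := by
      have hYZ : mul F Y Z = Z - mul F X Z := by
        rw [eq_sub_iff_add_eq', ← LinearMap.add_apply, ← map_add, hXY, unit_mul]
      have hXZ := Γ.mul_mem 1 k X hX Z hZ
      rw [one_mul] at hXZ
      exact hYZ ▸ sub_mem hZ hXZ
    have hne : mul F Y Z ∈ ⨆ (g) (_ : g ≠ k), Γ.comp g := by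
      have hle : ⨆ (g) (_ : g ≠ 1), Γ.comp g ≤
          (⨆ (g) (_ : g ≠ k), Γ.comp g).comap ((mul F).flip Z) :=
        iSup₂_le fun g hg W hW => Submodule.mem_iSup_of_mem (g * k) <|
          Submodule.mem_iSup_of_mem (by simpa using hg) (Γ.mul_mem g k W hW Z hZ)
      exact hle hY
    exact eq_zero_of_mem_of_mem_iSup_ne Γ.independent hk hne
  have hY0 : Y = 0 := by
    have hker : LinearMap.ker (mul F Y) = ⊤ := top_le_iff.1 (Γ.iSup_eq_top ▸ iSup_le hmul)
    rw [← mul_unit Y]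
    exact LinearMap.mem_ker.1 (hker ▸ Submodule.mem_top)
  rwa [← hXY, hY0, add_zero]

/-- The odd part of a homogeneous component, as a subspace of `OddVec F`. -/
def oddComp (g : G) : Submodule F (OddVec F) := (Γ.comp g).comap (oddMap F)

variable {Γ}

theorem mem_oddComp {g : G} {m : OddVec F} : m ∈ Γ.oddComp g ↔ oddMap F m ∈ Γ.comp g := Iff.rfl

theorem map_oddComp (g : G) : (Γ.oddComp g).map (oddMap F) = Γ.comp g ⊓ oddPart F := by
  rw [oddComp, Submodule.map_comap_eq, range_oddMap, inf_comm]

theorem iSupIndep_oddComp : iSupIndep Γ.oddComp := by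
  refine fun g => Submodule.disjoint_def.2 fun m hm hm' => oddMap_injective ?_
  have hle : ⨆ (k) (_ : k ≠ g), Γ.oddComp k ≤ (⨆ (k) (_ : k ≠ g), Γ.comp k).comap (oddMap F) :=
    iSup₂_le fun k hk _ hn => Submodule.mem_iSup_of_mem k (Submodule.mem_iSup_of_mem hk hn)
  rw [eq_zero_of_mem_of_mem_iSup_ne Γ.independent hm (hle hm'), map_zero]

theorem iSup_oddComp (hF : (2 : F) ≠ 0) : ⨆ g, Γ.oddComp g = ⊤ := by
  have hsup : (⨆ g, Γ.comp g ⊓ evenPart F) ⊔ (⨆ g, Γ.comp g ⊓ oddPart F) = ⊤ := by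
    rw [← iSup_sup_eq, ← Γ.iSup_eq_top]
    exact iSup_congr fun g => (Γ.super g).symm
  have heven : ⨆ g, Γ.comp g ⊓ evenPart F ≤ evenPart F := iSup_le fun _ => inf_le_right
  have hodd : ⨆ g, Γ.comp g ⊓ oddPart F ≤ oddPart F := iSup_le fun _ => inf_le_right
  refine Submodule.map_injective_of_injective oddMap_injective ?_
  rw [Submodule.map_iSup, Submodule.map_top, range_oddMap, iSup_congr map_oddComp]
  have h := sup_inf_assoc_of_le (⨆ g, Γ.comp g ⊓ evenPart F) hodd
  rwa [((disjoint_evenPart_oddPart hF).mono_left heven).eq_bot, sup_bot_eq, sup_comm, hsup,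
    top_inf_eq, eq_comm] at h

theorem mem_of_oddComp_le (Γ : Grading F G) (hF : (2 : F) ≠ 0) {S : Submodule F (OddVec F)}
    (h : ∀ g, Γ.oddComp g ≤ S) (m : OddVec F) : m ∈ S :=
  (iSup_oddComp (Γ := Γ) hF ▸ iSup_le h : (⊤ : Submodule F (OddVec F)) ≤ S) trivial

end Grading
end OddComponents

section Determination

namespace K10

theorem eq_top_of_mul_oddMap_mem (hF : (2 : F) ≠ 0) {S : Submodule F (K10 F)}
    (hone : one F ∈ S) (hodd : ∀ m, oddMap F m ∈ S)
    (hmul : ∀ m n, mul F (oddMap F m) (oddMap F n) ∈ S) : S = ⊤ := by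
  rw [← S.ker_mkQ, LinearMap.ker_eq_top]
  apply hom_ext <;> simp only [LinearMap.zero_apply, Submodule.mkQ_apply,
    Submodule.Quotient.mk_eq_zero]
  · exact hone
  · have hskew : K3.skew (F := F) ![1, 0] ![0, 1] = 1 := by simp [K3.skew]
    have h := hmul (![1, 0], 0) (![0, 1], 0)
    rw [← tmul_odd_a, ← tmul_odd_a, mul_wa_wa, hskew, one_smul] at h
    simpa using add_mem h (Submodule.smul_mem S (3 / 4 * 2⁻¹) hone)
  · intro x y
    have h := hmul (x, 0) (0, y)
    rw [← tmul_odd_a, ← tmul_a_odd, mul_wa_aw] at h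
    exact (Submodule.smul_mem_iff _ (by simpa using hF)).1 h
  · exact fun x => tmul_odd_a x ▸ hodd _
  · exact fun y => tmul_a_odd y ▸ hodd _

end K10

namespace Grading

open K10

variable {G : Type u} [CommGroup G] {Γ Γ' : Grading F G}

theorem eq_of_oddComp_eq (hF : (2 : F) ≠ 0) (h : Γ.oddComp = Γ'.oddComp) : Γ = Γ' := by
  have hodd {g : G} {m : OddVec F} (hm : m ∈ Γ.oddComp g) : oddMap F m ∈ Γ.comp g ⊓ Γ'.comp g :=
    ⟨hm, (congrFun h g ▸ hm : m ∈ Γ'.oddComp g)⟩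
  let S := ⨆ g, Γ.comp g ⊓ Γ'.comp g
  have htop : S = ⊤ := by
    refine eq_top_of_mul_oddMap_mem hF (Submodule.mem_iSup_of_mem 1 ⟨Γ.one_mem, Γ'.one_mem⟩)
      (Γ.mem_of_oddComp_le hF (S := S.comap (oddMap F))
        fun g m hm => Submodule.mem_iSup_of_mem g (hodd hm)) fun m n => ?_
    refine Γ.mem_of_oddComp_le hF (S := S.comap ((mul F).flip (oddMap F n) ∘ₗ oddMap F))
      (fun g p hp => ?_) m
    refine Γ.mem_of_oddComp_le hF (S := S.comap (mul F (oddMap F p) ∘ₗ oddMap F))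
      (fun k q hq => Submodule.mem_iSup_of_mem (g * k) ?_) n
    exact ⟨Γ.mul_mem _ _ _ (hodd hp).1 _ (hodd hq).1, Γ'.mul_mem _ _ _ (hodd hp).2 _ (hodd hq).2⟩
  have hΓ := (Γ.independent.le_iff_eq_of_iSup_eq_top htop).1 fun _ => inf_le_left
  have hΓ' := (Γ'.independent.le_iff_eq_of_iSup_eq_top htop).1 fun _ => inf_le_right
  exact Grading.ext (hΓ.symm.trans hΓ')

end Grading
end Determination

section OddBases

/-- The basis `u ⊗ a, v ⊗ a, a ⊗ u, a ⊗ v` of the odd part. -/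
def oddBasis1 (F : Type w) [Field F] : Module.Basis (Fin 4) F (OddVec F) :=
  basisOfTopLeSpanOfCardEqFinrank ![(![1, 0], 0), (![0, 1], 0), (0, ![1, 0]), (0, ![0, 1])]
    (fun m _ => Submodule.mem_span_range_iff_exists_fun F |>.2
      ⟨![m.1 0, m.1 1, m.2 0, m.2 1], by ext i <;> fin_cases i <;> simp [Fin.sum_univ_four]⟩)
    (by simp)

/-- The basis `u ⊗ a + a ⊗ u, v ⊗ a + a ⊗ v, u ⊗ a - a ⊗ u, v ⊗ a - a ⊗ v` of the odd part. -/
def oddBasis2 (hF : (2 : F) ≠ 0) : Module.Basis (Fin 4) F (OddVec F) :=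
  basisOfTopLeSpanOfCardEqFinrank
    ![(![1, 0], ![1, 0]), (![0, 1], ![0, 1]), (![1, 0], -![1, 0]), (![0, 1], -![0, 1])]
    (fun m _ => Submodule.mem_span_range_iff_exists_fun F |>.2
      ⟨![(m.1 0 + m.2 0) / 2, (m.1 1 + m.2 1) / 2, (m.1 0 - m.2 0) / 2, (m.1 1 - m.2 1) / 2], by
        ext i <;> fin_cases i <;> simp [Fin.sum_univ_four] <;> field_simp <;> ring⟩)
    (by simp)

theorem coe_oddBasis1 : ⇑(oddBasis1 F) =
    ![(![1, 0], 0), (![0, 1], 0), (0, ![1, 0]), (0, ![0, 1])] :=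
  coe_basisOfTopLeSpanOfCardEqFinrank _ _ _

theorem coe_oddBasis2 (hF : (2 : F) ≠ 0) : ⇑(oddBasis2 hF) =
    ![(![1, 0], ![1, 0]), (![0, 1], ![0, 1]), (![1, 0], -![1, 0]), (![0, 1], -![0, 1])] :=
  coe_basisOfTopLeSpanOfCardEqFinrank _ _ _

namespace Grading

open K10

variable {G : Type u} [CommGroup G] {Γ Γ' : Grading F G} {g₁ g₂ g h : G}

theorem isGamma1_iff : Γ.IsGamma1 g₁ g₂ ↔
    ∀ i, oddBasis1 F i ∈ Γ.oddComp (![g₁, g₁⁻¹, g₂, g₂⁻¹] i) := by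
  simp [IsGamma1, Fin.forall_fin_succ, coe_oddBasis1, mem_oddComp, ← tmul_odd_a, ← tmul_a_odd,
    K3.u, K3.v]

theorem isGamma2_iff (hF : (2 : F) ≠ 0) : Γ.IsGamma2 g h ↔
    ∀ i, oddBasis2 hF i ∈ Γ.oddComp (![g, g⁻¹, g * h, (g * h)⁻¹] i) := by
  simp [IsGamma2, Fin.forall_fin_succ, coe_oddBasis2, mem_oddComp, tmul_odd_a, tmul_a_odd,
    ← map_add, ← map_sub, K3.u, K3.v]

theorem IsGamma1.oddComp_eq (hΓ : Γ.IsGamma1 g₁ g₂) :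
    Γ.oddComp = homogeneousSpan (oddBasis1 F) ![g₁, g₁⁻¹, g₂, g₂⁻¹] :=
  eq_homogeneousSpan iSupIndep_oddComp (isGamma1_iff.1 hΓ)

theorem IsGamma2.oddComp_eq (hF : (2 : F) ≠ 0) (hΓ : Γ.IsGamma2 g h) :
    Γ.oddComp = homogeneousSpan (oddBasis2 hF) ![g, g⁻¹, g * h, (g * h)⁻¹] :=
  eq_homogeneousSpan iSupIndep_oddComp ((isGamma2_iff hF).1 hΓ)

theorem IsGamma1.eq (hF : (2 : F) ≠ 0) (hΓ : Γ.IsGamma1 g₁ g₂) (hΓ' : Γ'.IsGamma1 g₁ g₂) :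
    Γ = Γ' :=
  eq_of_oddComp_eq hF (hΓ.oddComp_eq.trans hΓ'.oddComp_eq.symm)

theorem IsGamma2.eq (hF : (2 : F) ≠ 0) (hΓ : Γ.IsGamma2 g h) (hΓ' : Γ'.IsGamma2 g h) :
    Γ = Γ' :=
  eq_of_oddComp_eq hF ((hΓ.oddComp_eq hF).trans (hΓ'.oddComp_eq hF).symm)

end Grading

end OddBases

section OddFlip

theorem oddFlip_oddFlip (m : OddVec F) : oddFlip (oddFlip m) = m := by simp [oddFlip_apply]

-- Contracting with the form turns the hypothesis into `K m ∧ K n = m ∧ n`.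
theorem exists_eq_smul_of_oddForm_smul_sub {K : OddVec F →ₗ[F] OddVec F}
    (hK : ∀ m n p, oddForm (K m) p • K n - oddForm (K n) p • K m =
      oddForm m p • n - oddForm n p • m) : ∃ c : F, K = c • LinearMap.id := by
  refine LinearMap.exists_eq_smul_id_of_forall_notLinearIndependent fun m hm => ?_
  have hKm : K m ≠ 0 := hm.ne_zero 1
  have h (n : OddVec F) :
      oddForm (K n) (K m) • K m = oddForm n (K m) • m - oddForm m (K m) • n := by
    have := hK n m (K m)
    rwa [oddForm_self, zero_smul, sub_zero] at this
  by_cases hc : oddForm m (K m) = 0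
  · refine hKm (separatingLeft_oddForm _ fun n => ?_)
    have hn := h n
    rw [hc, zero_smul, sub_zero] at hn
    have := LinearIndependent.pair_iff.1 hm (oddForm n (K m)) (-oddForm (K n) (K m))
      (by rw [← hn, neg_smul, add_neg_cancel])
    rw [oddForm_swap, this.1, neg_zero]
  · have htop : Submodule.span F (Set.range ![m, K m]) = ⊤ := by
      refine top_le_iff.1 fun n _ => (Submodule.smul_mem_iff _ hc).1 ?_
      have hn : oddForm m (K m) • n = oddForm n (K m) • m - oddForm (K n) (K m) • K m := by
        rw [h n, sub_sub_cancel]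
      rw [hn]
      exact sub_mem (Submodule.smul_mem _ _ (Submodule.subset_span ⟨0, rfl⟩))
        (Submodule.smul_mem _ _ (Submodule.subset_span ⟨1, rfl⟩))
    have hrank := Module.finrank_eq_card_basis (Module.Basis.mk hm htop.ge)
    simp at hrank

theorem oddForm_map_of_oddTriple_map (hF : (2 : F) ≠ 0) {ψ : OddVec F ≃ₗ[F] OddVec F}
    (hψ : ∀ m n p, ψ (oddTriple m n p) = oddTriple (ψ m) (ψ n) (ψ p)) (m n : OddVec F) :
    oddForm (ψ m) (ψ n) = oddForm m n := by
  have hconj : oddTriple (ψ m) (ψ n) = ψ.conj (oddTriple m n) :=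
    LinearMap.ext fun p => by simp [LinearEquiv.conj_apply, hψ]
  have h4 : (4 : F) ≠ 0 := by simpa [show (4 : F) = 2 * 2 by norm_num] using hF
  refine mul_left_cancel₀ h4 ?_
  rw [← trace_oddTriple, hconj, LinearMap.trace_conj', trace_oddTriple]

theorem exists_oddFlip_map_eq_smul (hF : (2 : F) ≠ 0) {ψ : OddVec F ≃ₗ[F] OddVec F}
    (hψ : ∀ m n p, ψ (oddTriple m n p) = oddTriple (ψ m) (ψ n) (ψ p)) :
    ∃ c : F, ∀ m, oddFlip (ψ m) = c • ψ (oddFlip m) := by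
  have hform := oddForm_map_of_oddTriple_map hF hψ
  let K : OddVec F →ₗ[F] OddVec F := ψ.symm.toLinearMap ∘ₗ oddFlip ∘ₗ ψ.toLinearMap ∘ₗ oddFlip
  have hK (m : OddVec F) : ψ (K m) = oddFlip (ψ (oddFlip m)) := ψ.apply_symm_apply _
  obtain ⟨c, hc⟩ := exists_eq_smul_of_oddForm_smul_sub (K := K) fun m n p => by
    have h := oddForm_oddFlip_smul_sub (oddFlip m) (oddFlip n) p
    rw [oddFlip_oddFlip, oddFlip_oddFlip] at h
    refine ψ.injective ?_
    rw [h, map_sub, map_smul, map_smul, hK, hK, ← hform, ← hform (K n), hK, hK,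
      oddForm_oddFlip_smul_sub]
    simp only [map_add, map_sub, map_smul, hψ, hform]
  refine ⟨c, fun m => ?_⟩
  have hm := hK (oddFlip m)
  rwa [oddFlip_oddFlip, hc, LinearMap.smul_apply, map_smul, LinearMap.id_apply, eq_comm] at hm

namespace K10

theorem IsAut.exists_oddEquiv {φ : K10 F ≃ₗ[F] K10 F} (hφ : IsAut φ) :
    ∃ ψ : OddVec F ≃ₗ[F] OddVec F, ∀ m, φ (oddMap F m) = oddMap F (ψ m) := by
  obtain ⟨L, hL⟩ := (oddMap F).exists_leftInverse_of_injective
    (LinearMap.ker_eq_bot.2 oddMap_injective)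
  have h (m : OddVec F) : φ (oddMap F m) = oddMap F ((L ∘ₗ φ.toLinearMap ∘ₗ oddMap F) m) := by
    obtain ⟨n, hn⟩ := range_oddMap (F := F) ▸ hφ.apply_mem_oddPart (oddMap_mem_oddPart m)
    simpa [← hn] using congrArg (oddMap F) (LinearMap.congr_fun hL n).symm
  refine ⟨LinearEquiv.ofInjectiveEndo (L ∘ₗ φ.toLinearMap ∘ₗ oddMap F) fun m n hmn => ?_, h⟩
  exact oddMap_injective (φ.injective (by rw [h m, h n, hmn]))

theorem IsAut.exists_oddFlip_map_eq_smul (hF : (2 : F) ≠ 0) {φ : K10 F ≃ₗ[F] K10 F}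
    (hφ : IsAut φ) : ∃ (ψ : OddVec F ≃ₗ[F] OddVec F) (c : F),
      (∀ m, φ (oddMap F m) = oddMap F (ψ m)) ∧ ∀ m, oddFlip (ψ m) = c • ψ (oddFlip m) := by
  obtain ⟨ψ, hψ⟩ := hφ.exists_oddEquiv
  obtain ⟨c, hc⟩ := Kac.exists_oddFlip_map_eq_smul hF (ψ := ψ) fun m n p =>
    oddMap_injective <| by
      rw [← hψ, ← mul_mul_oddMap hF, ← mul_mul_oddMap hF, map_smul, hφ.1, hφ.1, hψ, hψ, hψ]
  exact ⟨ψ, c, hψ, hc⟩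

end K10

namespace Grading

open K10

variable {G : Type u} [CommGroup G] {H : Type v} [CommGroup H] {Γ : Grading F G}
  {Γ' : Grading F H} {h : G} {h' : H}

/-- The involution `oddFlip` of the odd part is homogeneous of degree `h`. -/
def HasFlipDegree (Γ : Grading F G) (h : G) : Prop :=
  ∀ g, Γ.oddComp g ≤ (Γ.oddComp (g * h)).comap oddFlip

theorem exists_oddComp_ne_bot (hF : (2 : F) ≠ 0) (Γ : Grading F G) : ∃ g, Γ.oddComp g ≠ ⊥ := by
  by_contra! hbot
  have h := Γ.mem_of_oddComp_le hF (S := ⊥) (fun g => (hbot g).le) (![1, 0], 0)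
  simp at h

theorem HasFlipDegree.eq_mul_of_map_eq (hF : (2 : F) ≠ 0) (hΓ : Γ.HasFlipDegree h)
    (hΓ' : Γ'.HasFlipDegree h') {φ : K10 F ≃ₗ[F] K10 F} (hφ : IsAut φ) {g : G} {k l : H}
    (hg : Γ.oddComp g ≠ ⊥) (hk : (Γ.comp g).map φ.toLinearMap = Γ'.comp k)
    (hl : (Γ.comp (g * h)).map φ.toLinearMap = Γ'.comp l) : l = k * h' := by
  obtain ⟨ψ, c, hψ, hc⟩ := hφ.exists_oddFlip_map_eq_smul hF
  obtain ⟨m, hm, hm0⟩ := Submodule.exists_mem_ne_zero_of_ne_bot hg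
  have hflip : oddFlip (ψ m) ∈ Γ'.oddComp (k * h') :=
    hΓ' k (by rw [mem_oddComp, ← hψ, ← hk]; exact ⟨_, hm, rfl⟩)
  have hflip' : oddFlip (ψ m) ∈ Γ'.oddComp l := by
    rw [hc]
    refine Submodule.smul_mem _ _ ?_
    rw [mem_oddComp, ← hψ, ← hl]
    exact ⟨_, hΓ g hm, rfl⟩
  by_contra hne
  refine hm0 (ψ.map_eq_zero_iff.1 ?_)
  rw [← oddFlip_oddFlip (ψ m),
    eq_zero_of_mem_of_mem (A := Γ'.oddComp) iSupIndep_oddComp hne hflip' hflip, map_zero]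

theorem HasFlipDegree.eq_of_iso (hF : (2 : F) ≠ 0) {Γ' : Grading F G} {h' : G}
    (hΓ : Γ.HasFlipDegree h) (hΓ' : Γ'.HasFlipDegree h') (hiso : Γ.Iso Γ') : h = h' := by
  obtain ⟨φ, hφ, hcomp⟩ := hiso
  obtain ⟨g, hg⟩ := Γ.exists_oddComp_ne_bot hF
  exact mul_left_cancel (hΓ.eq_mul_of_map_eq hF hΓ' hφ hg (hcomp g) (hcomp _))

theorem HasFlipDegree.eq_one_of_equivalent (hF : (2 : F) ≠ 0) (hΓ : Γ.HasFlipDegree 1)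
    (hΓ' : Γ'.HasFlipDegree h') (hequiv : Γ.Equivalent Γ') : h' = 1 := by
  obtain ⟨φ, hφ, hcomp⟩ := hequiv
  obtain ⟨g, hg⟩ := Γ.exists_oddComp_ne_bot hF
  have hsupp : g ∈ Γ.support := by
    refine fun hbot => hg ?_
    rw [oddComp, hbot, Submodule.comap_bot, LinearMap.ker_eq_bot.2 oddMap_injective]
  obtain ⟨k, -, hk⟩ := hcomp g hsupp
  exact (left_eq_mul.1 (hΓ.eq_mul_of_map_eq hF hΓ' hφ hg hk (by rwa [mul_one])))

theorem IsGamma1.hasFlipDegree {g₁ g₂ : G} (hΓ : Γ.IsGamma1 g₁ g₂) : Γ.HasFlipDegree 1 := by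
  intro k
  rw [mul_one, hΓ.oddComp_eq, homogeneousSpan_le]
  rintro i rfl
  have hi : oddFlip (oddBasis1 F i) = (![1, 1, -1, -1] i : F) • oddBasis1 F i := by
    fin_cases i <;> simp [coe_oddBasis1, oddFlip_apply]
  rw [Submodule.mem_comap, hi]
  exact Submodule.smul_mem _ _ (basis_mem_homogeneousSpan i)

theorem IsGamma2.hasFlipDegree (hF : (2 : F) ≠ 0) {g : G} (hΓ : Γ.IsGamma2 g h)
    (hh : h ^ 2 = 1) : Γ.HasFlipDegree h := by
  have hinv : h⁻¹ = h := inv_eq_of_mul_eq_one_right (by rw [← sq, hh])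
  intro k
  rw [hΓ.oddComp_eq hF, homogeneousSpan_le]
  rintro i rfl
  have hi : oddFlip (oddBasis2 hF i) = oddBasis2 hF (![2, 3, 0, 1] i) := by
    fin_cases i <;> simp [coe_oddBasis2, oddFlip_apply]
  have hdeg : ![g, g⁻¹, g * h, (g * h)⁻¹] i * h =
      ![g, g⁻¹, g * h, (g * h)⁻¹] (![2, 3, 0, 1] i) := by
    fin_cases i <;> simp [mul_assoc, ← sq, hh, hinv, mul_comm h]
  rw [Submodule.mem_comap, hi, hdeg]
  exact basis_mem_homogeneousSpan _

end Grading

end OddFlip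

section Existence

namespace K3

/-- The basis `a, u, v` of `K3`. -/
def basis (F : Type w) [Field F] : Module.Basis (Unit ⊕ Fin 2) F (K3 F) :=
  (Module.Basis.singleton Unit F).prod (Pi.basisFun F (Fin 2))

/-- The degrees of `a, u, v` in the `ℤ`-grading of `K3` with `u` of degree `1`. -/
def weight : Unit ⊕ Fin 2 → ℤ := Sum.elim 0 ![1, -1]

@[simp] theorem weight_inl (i : Unit) : weight (Sum.inl i) = 0 := rfl

@[simp] theorem weight_inr (i : Fin 2) : weight (Sum.inr i) = ![1, -1] i := rfl

@[simp] theorem basis_inl (i : Unit) : basis F (Sum.inl i) = a F := by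
  simp [basis, a]

@[simp] theorem basis_inr (i : Fin 2) : basis F (Sum.inr i) = odd (Pi.single i 1) := by
  simp [basis, odd]

theorem u_eq_basis : u F = basis F (Sum.inr 0) := by
  ext i <;> [simp [u, odd]; fin_cases i <;> simp [u, odd]]

theorem v_eq_basis : v F = basis F (Sum.inr 1) := by
  ext i <;> [simp [v, odd]; fin_cases i <;> simp [v, odd]]

theorem mul_basis_mem (i j : Unit ⊕ Fin 2) :
    mul F (basis F i) (basis F j) ∈ homogeneousSpan (basis F) weight (weight i + weight j) := by
  have ha : a F ∈ homogeneousSpan (basis F) weight 0 := by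
    simpa using basis_mem_homogeneousSpan (b := basis F) (d := weight) (Sum.inl ())
  have hodd (k : Fin 2) :=
    basis_mem_homogeneousSpan (b := basis F) (d := weight) (Sum.inr k)
  rcases i with - | i <;> rcases j with - | j
  · simpa using ha
  · simpa using Submodule.smul_mem _ (2⁻¹ : F) (hodd j)
  · simpa using Submodule.smul_mem _ (2⁻¹ : F) (hodd i)
  · fin_cases i <;> fin_cases j <;> simp [skew, ha]

theorem form_basis_eq_zero {i j : Unit ⊕ Fin 2} (h : weight i + weight j ≠ 0) :
    form F (basis F i) (basis F j) = 0 := by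
  revert h
  rcases i with - | i <;> rcases j with - | j
  · simp
  · simp
  · simp
  · fin_cases i <;> fin_cases j <;> simp [skew]

end K3

namespace K10

/-- The basis of `K10` that consists of `1` and of the tensors of elements of `K3.basis`. -/
def basis (F : Type w) [Field F] :
    Module.Basis (Unit ⊕ (Unit ⊕ Fin 2) × (Unit ⊕ Fin 2)) F (K10 F) :=
  (Module.Basis.singleton Unit F).prod ((K3.basis F).tensorProduct (K3.basis F))

/-- The degrees of the elements of `K10.basis`: `1` has degree `0` and `x ⊗ y` has the weights
of `x` and `y` as components of its degree. -/
def weight : Unit ⊕ (Unit ⊕ Fin 2) × (Unit ⊕ Fin 2) → Multiplicative (ℤ × ℤ) :=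
  Sum.elim 1 fun i => .ofAdd (K3.weight i.1, K3.weight i.2)

@[simp] theorem basis_inl (i : Unit) : basis F (Sum.inl i) = one F := by
  simp [basis, one]

@[simp] theorem basis_inr (i j : Unit ⊕ Fin 2) :
    basis F (Sum.inr (i, j)) = tmul (K3.basis F i) (K3.basis F j) := by
  simp [basis, tmul]

theorem tmul_mem_homogeneousSpan {x y : K3 F} {p q : ℤ}
    (hx : x ∈ homogeneousSpan (K3.basis F) K3.weight p)
    (hy : y ∈ homogeneousSpan (K3.basis F) K3.weight q) :
    tmul x y ∈ homogeneousSpan (basis F) weight (.ofAdd (p, q)) := by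
  refine apply_mem_of_mem_homogeneousSpan
    (f := (TensorProduct.mk F _ _).compr₂ (LinearMap.inr F F _)) ?_ hx hy
  rintro i j rfl rfl
  change tmul _ _ ∈ _
  rw [← basis_inr]
  exact basis_mem_homogeneousSpan (Sum.inr (i, j))

theorem exists_mul_basis_inr (i j k l : Unit ⊕ Fin 2) : ∃ ε : F,
    mul F (basis F (Sum.inr (i, j))) (basis F (Sum.inr (k, l))) =
      ε • (tmul (K3.mul F (K3.basis F i) (K3.basis F k))
          (K3.mul F (K3.basis F j) (K3.basis F l)) -
        ((3 / 4 : F) * (K3.form F (K3.basis F i) (K3.basis F k) *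
          K3.form F (K3.basis F j) (K3.basis F l))) • one F) := by
  simp only [basis_inr]
  rcases j with - | j
  · exact ⟨1, by rw [K3.basis_inl, mul_tmul_a, one_smul]⟩
  · rcases k with - | k
    · exact ⟨1, by rw [K3.basis_inl, mul_a_tmul, one_smul]⟩
    · refine ⟨-1, ?_⟩
      rw [K3.basis_inr, K3.basis_inr, mul_tmul_tmul_of_odd_odd]
      exact (neg_one_smul F _).symm

theorem mul_basis_mem (i j : Unit ⊕ (Unit ⊕ Fin 2) × (Unit ⊕ Fin 2)) :
    mul F (basis F i) (basis F j) ∈ homogeneousSpan (basis F) weight (weight i * weight j) := by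
  rcases i with - | ⟨i, j'⟩
  · simpa [weight] using basis_mem_homogeneousSpan (b := basis F) (d := weight) j
  rcases j with - | ⟨k, l⟩
  · simpa [weight] using basis_mem_homogeneousSpan (b := basis F) (d := weight) (Sum.inr (i, j'))
  obtain ⟨ε, hε⟩ := exists_mul_basis_inr (F := F) i j' k l
  rw [hε]
  refine Submodule.smul_mem _ _ (sub_mem
    (tmul_mem_homogeneousSpan (K3.mul_basis_mem i k) (K3.mul_basis_mem j' l)) ?_)
  by_cases hik : K3.weight i + K3.weight k = 0
  · by_cases hjl : K3.weight j' + K3.weight l = 0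
    · have hone : weight (Sum.inr (i, j')) * weight (Sum.inr (k, l)) = weight (Sum.inl ()) := by
        simp [weight, ← ofAdd_add, hik, hjl]
      rw [hone, ← basis_inl ()]
      exact Submodule.smul_mem _ _ (basis_mem_homogeneousSpan _)
    · simp [K3.form_basis_eq_zero hjl]
  · simp [K3.form_basis_eq_zero hik]

theorem basis_mem_evenPart_or_mem_oddPart (i : Unit ⊕ (Unit ⊕ Fin 2) × (Unit ⊕ Fin 2)) :
    basis F i ∈ evenPart F ∨ basis F i ∈ oddPart F := by
  rcases i with - | ⟨- | i, - | j⟩ <;> simp only [basis_inl, basis_inr, K3.basis_inl, K3.basis_inr]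
  · exact Or.inl (Submodule.subset_span (by simp))
  · exact Or.inl (Submodule.subset_span (by simp))
  · exact Or.inr (Submodule.subset_span (Or.inr ⟨_, rfl⟩))
  · exact Or.inr (Submodule.subset_span (Or.inl ⟨_, rfl⟩))
  · exact Or.inl (Submodule.subset_span (Or.inr ⟨_, _, rfl⟩))

end K10

namespace Grading

open K10

/-- The grading for which each element `b i` of a basis of `K10` is homogeneous of degree
`d i`. -/
def ofBasis {G : Type u} [CommGroup G] {ι : Type*} (b : Module.Basis ι F (K10 F)) (d : ι → G)
    (hmul : ∀ i j, mul F (b i) (b j) ∈ homogeneousSpan b d (d i * d j))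
    (hsuper : ∀ i, b i ∈ evenPart F ∨ b i ∈ oddPart F) : Grading F G where
  comp := homogeneousSpan b d
  independent := iSupIndep_homogeneousSpan
  iSup_eq_top := iSup_homogeneousSpan
  mul_mem g h X hX Y hY := by
    refine apply_mem_of_mem_homogeneousSpan ?_ hX hY
    rintro i j rfl rfl
    exact hmul i j
  super g := by
    refine le_antisymm (homogeneousSpan_le.2 ?_) (sup_le inf_le_left inf_le_left)
    rintro i rfl
    rcases hsuper i with hi | hi
    · exact Submodule.mem_sup_left ⟨basis_mem_homogeneousSpan i, hi⟩
    · exact Submodule.mem_sup_right ⟨basis_mem_homogeneousSpan i, hi⟩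

/-- The grading `Γ¹(ℤ²; (1, 0), (0, 1))`. -/
def universal1 (F : Type w) [Field F] : Grading F (Multiplicative (ℤ × ℤ)) :=
  ofBasis (K10.basis F) K10.weight mul_basis_mem basis_mem_evenPart_or_mem_oddPart

theorem isGamma1_universal1 : (universal1 F).IsGamma1 (.ofAdd (1, 0)) (.ofAdd (0, 1)) := by
  have hmem (i j : Unit ⊕ Fin 2) : tmul (K3.basis F i) (K3.basis F j) ∈
      (universal1 F).comp (.ofAdd (K3.weight i, K3.weight j)) := by
    rw [← basis_inr]
    exact basis_mem_homogeneousSpan (Sum.inr (i, j))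
  refine ⟨?_, ?_, ?_, ?_⟩
  · simpa [K3.u_eq_basis] using hmem (Sum.inr 0) (Sum.inl ())
  · simpa [K3.v_eq_basis, ← ofAdd_neg] using hmem (Sum.inr 1) (Sum.inl ())
  · simpa [K3.u_eq_basis] using hmem (Sum.inl ()) (Sum.inr 0)
  · simpa [K3.v_eq_basis, ← ofAdd_neg] using hmem (Sum.inl ()) (Sum.inr 1)

end Grading

end Existence

section Coarsening

namespace Grading

open K10

variable {G : Type u} [CommGroup G] {H : Type v} [CommGroup H]

/-- The grading by `H` obtained by replacing each degree `g` with `f g`. -/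
def coarsen (Γ : Grading F G) (f : G →* H) : Grading F H where
  comp h := ⨆ g ∈ f ⁻¹' {h}, Γ.comp g
  independent h := by
    have hdisj : Disjoint (f ⁻¹' {h}) (f ⁻¹' {h}ᶜ) := Set.disjoint_left.2 fun _ h h' => h' h
    refine (Γ.independent.disjoint_biSup_biSup hdisj).mono_right ?_
    refine iSup₂_le fun k hk => iSup₂_le fun g hg => le_biSup Γ.comp ?_
    rintro rfl
    exact hk (Set.mem_singleton_iff.1 hg).symm
  iSup_eq_top := by
    refine top_le_iff.1 (Γ.iSup_eq_top.symm.le.trans (iSup_le fun g => ?_))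
    exact le_iSup_of_le (f g) (le_biSup Γ.comp (rfl : g ∈ f ⁻¹' {f g}))
  mul_mem h k X hX Y hY := by
    suffices hXk : ∀ l ∈ f ⁻¹' {k}, Γ.comp l ≤
        (⨆ g ∈ f ⁻¹' {h * k}, Γ.comp g).comap (mul F X) from iSup₂_le hXk hY
    rintro l rfl Z hZ
    suffices hhZ : ∀ g ∈ f ⁻¹' {h}, Γ.comp g ≤
        (⨆ g ∈ f ⁻¹' {h * f l}, Γ.comp g).comap ((mul F).flip Z) from iSup₂_le hhZ hX
    rintro g rfl Y hY
    have hgl : g * l ∈ f ⁻¹' {f g * f l} := map_mul f g l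
    exact le_biSup Γ.comp hgl (Γ.mul_mem g l Y hY Z hZ)
  super h := by
    refine le_antisymm (iSup₂_le fun g hg => (Γ.super g).le.trans ?_)
      (sup_le inf_le_left inf_le_left)
    exact sup_le_sup (inf_le_inf_right _ (le_biSup Γ.comp hg))
      (inf_le_inf_right _ (le_biSup Γ.comp hg))

theorem comp_le_coarsen (Γ : Grading F G) (f : G →* H) (g : G) :
    Γ.comp g ≤ (Γ.coarsen f).comp (f g) :=
  le_biSup Γ.comp (rfl : g ∈ f ⁻¹' {f g})

theorem coarsen_comp_of_injective (Γ : Grading F G) {f : G →* H} (hf : Function.Injective f)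
    (g : G) : (Γ.coarsen f).comp (f g) = Γ.comp g := by
  simp [coarsen, hf.eq_iff]

theorem IsGamma1.coarsen {Γ : Grading F G} {g₁ g₂ : G} (hΓ : Γ.IsGamma1 g₁ g₂) (f : G →* H) :
    (Γ.coarsen f).IsGamma1 (f g₁) (f g₂) := by
  simp only [IsGamma1, ← map_inv]
  exact hΓ.imp (Γ.comp_le_coarsen f _ ·) <| And.imp (Γ.comp_le_coarsen f _ ·) <|
    And.imp (Γ.comp_le_coarsen f _ ·) (Γ.comp_le_coarsen f _ ·)

theorem IsGamma2.coarsen {Γ : Grading F G} {g h : G} (hΓ : Γ.IsGamma2 g h) (f : G →* H) :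
    (Γ.coarsen f).IsGamma2 (f g) (f h) := by
  simp only [IsGamma2, ← map_inv, ← map_mul]
  exact hΓ.imp (Γ.comp_le_coarsen f _ ·) <| And.imp (Γ.comp_le_coarsen f _ ·) <|
    And.imp (Γ.comp_le_coarsen f _ ·) (Γ.comp_le_coarsen f _ ·)

end Grading

end Coarsening

section Splitting

namespace Grading

open K10

variable {A : Type u} [AddCommGroup A] {φ : K10 F ≃ₗ[F] K10 F}

/-- The vectors of degree `k.1` that are multiplied by `(-1) ^ k.2` by `φ`. -/
def splitComp (Γ : Grading F (Multiplicative A)) (φ : K10 F ≃ₗ[F] K10 F)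
    (k : Multiplicative (A × ZMod 2)) : Submodule F (K10 F) :=
  Γ.comp (.ofAdd k.toAdd.1) ⊓
    φ.toLinearMap.eqLocus (((-1 : ℤˣ) ^ k.toAdd.2) • LinearMap.id)

variable {Γ : Grading F (Multiplicative A)}

theorem mem_splitComp {k : Multiplicative (A × ZMod 2)} {X : K10 F} :
    X ∈ Γ.splitComp φ k ↔
      X ∈ Γ.comp (.ofAdd k.toAdd.1) ∧ φ X = (-1 : ℤˣ) ^ k.toAdd.2 • X := Iff.rfl

theorem iSupIndep_splitComp (hF : (2 : F) ≠ 0)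
    (hΓ : ∀ g, Γ.comp g ≤ (Γ.comp g).comap φ.toLinearMap) : iSupIndep (Γ.splitComp φ) := by
  refine fun k => Submodule.disjoint_def.2 fun X hX hX' => ?_
  let P : K10 F →ₗ[F] K10 F := LinearMap.id + (-1 : ℤˣ) ^ k.toAdd.2 • φ.toLinearMap
  have hP (Y : K10 F) : P Y = Y + (-1 : ℤˣ) ^ k.toAdd.2 • φ Y := rfl
  have hle : ⨆ (l) (_ : l ≠ k), Γ.splitComp φ l ≤
      (⨆ (g) (_ : g ≠ .ofAdd k.toAdd.1), Γ.comp g).comap P := by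
    refine iSup₂_le fun l hl Y hY => ?_
    rw [mem_splitComp] at hY
    rw [Submodule.mem_comap, hP]
    by_cases h : l.toAdd.1 = k.toAdd.1
    · have h2 : l.toAdd.2 = k.toAdd.2 + 1 := by
        have hne : l.toAdd.2 ≠ k.toAdd.2 := fun h' => hl (Prod.ext h h')
        revert hne
        generalize l.toAdd.2 = x
        generalize k.toAdd.2 = y
        decide +revert
      rw [hY.2, smul_smul, h2, uzpow_add, ← mul_assoc, Int.units_mul_self, one_mul, uzpow_one,
        Units.neg_smul, one_smul, add_neg_cancel]
      exact zero_mem _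
    · refine Submodule.mem_iSup_of_mem _ (Submodule.mem_iSup_of_mem h ?_)
      exact add_mem hY.1 (Submodule.smul_of_tower_mem _ _ (hΓ _ hY.1))
  have h2X : P X = (2 : F) • X := by
    rw [hP, (mem_splitComp.1 hX).2, smul_smul, Int.units_mul_self, one_smul, two_smul]
  refine (smul_eq_zero.1 (eq_zero_of_mem_of_mem_iSup_ne Γ.independent
    (Submodule.smul_mem _ _ hX.1) (h2X ▸ hle hX'))).resolve_left hF

theorem iSup_splitComp (hF : (2 : F) ≠ 0) (hφ : ∀ X, φ (φ X) = X)
    (hΓ : ∀ g, Γ.comp g ≤ (Γ.comp g).comap φ.toLinearMap) : ⨆ k, Γ.splitComp φ k = ⊤ := by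
  refine top_le_iff.1 (Γ.iSup_eq_top.symm.le.trans (iSup_le fun g X hX => ?_))
  have hplus : X + φ X ∈ Γ.splitComp φ (.ofAdd (g.toAdd, 0)) :=
    mem_splitComp.2 ⟨add_mem hX (hΓ g hX), by simp [hφ, add_comm]⟩
  have hminus : X - φ X ∈ Γ.splitComp φ (.ofAdd (g.toAdd, 1)) :=
    mem_splitComp.2 ⟨sub_mem hX (hΓ g hX), by simp [hφ]⟩
  rw [← Submodule.smul_mem_iff _ hF, two_smul, ← add_add_sub_cancel]
  exact add_mem (Submodule.mem_iSup_of_mem _ hplus) (Submodule.mem_iSup_of_mem _ hminus)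

/-- The refinement of a grading of `K10` by the eigenspaces of an involutive automorphism that
preserves its components. -/
def split (hF : (2 : F) ≠ 0) (Γ : Grading F (Multiplicative A)) (hφ : IsAut φ)
    (hφφ : ∀ X, φ (φ X) = X) (hΓ : ∀ g, Γ.comp g ≤ (Γ.comp g).comap φ.toLinearMap) :
    Grading F (Multiplicative (A × ZMod 2)) where
  comp := Γ.splitComp φ
  independent := iSupIndep_splitComp hF hΓ
  iSup_eq_top := iSup_splitComp hF hφφ hΓ
  mul_mem k l X hX Y hY := by
    rw [mem_splitComp] at hX hY ⊢
    refine ⟨Γ.mul_mem _ _ X hX.1 Y hY.1, ?_⟩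
    rw [hφ.1, hX.2, hY.2, toAdd_mul, Prod.snd_add, uzpow_add]
    simp only [mul_smul, Units.smul_def, map_zsmul, LinearMap.smul_apply]
    exact smul_comm _ _ _
  super k := by
    refine le_antisymm (fun X hX => ?_) (sup_le inf_le_left inf_le_left)
    rw [mem_splitComp] at hX
    obtain ⟨E, hE, O, hO, rfl⟩ := Submodule.mem_sup.1 ((Γ.super _).le hX.1)
    set ε := (-1 : ℤˣ) ^ k.toAdd.2
    have hEO : φ E - ε • E = -(φ O - ε • O) := by
      rw [eq_neg_iff_add_eq_zero, sub_add_sub_comm, ← map_add, ← smul_add, hX.2, sub_self]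
    have hE0 : φ E - ε • E = 0 := by
      refine Submodule.disjoint_def.1 (disjoint_evenPart_oddPart hF) _
        (sub_mem (hφ.apply_mem_evenPart hE.2) (Submodule.smul_of_tower_mem _ _ hE.2)) ?_
      rw [hEO]
      exact neg_mem (sub_mem (hφ.apply_mem_oddPart hO.2) (Submodule.smul_of_tower_mem _ _ hO.2))
    have hO0 : φ O - ε • O = 0 := by rwa [hE0, zero_eq_neg] at hEO
    exact Submodule.add_mem_sup ⟨mem_splitComp.2 ⟨hE.1, sub_eq_zero.1 hE0⟩, hE.2⟩
      ⟨mem_splitComp.2 ⟨hO.1, sub_eq_zero.1 hO0⟩, hO.2⟩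

end Grading

end Splitting

section Transport

/-- The linear automorphism of `W` with given images `x` and `y` of `u` and `v`. -/
def symplecticEquiv {x y : Fin 2 → F} (h : K3.skew x y = 1) :
    (Fin 2 → F) ≃ₗ[F] (Fin 2 → F) where
  toFun z := z 0 • x + z 1 • y
  map_add' z z' := by simp only [Pi.add_apply]; module
  map_smul' c z := by simp only [Pi.smul_apply, smul_eq_mul, RingHom.id_apply]; module
  invFun z := ![K3.skew z y, K3.skew x z]
  left_inv z := by
    simp only [K3.skew] at h
    ext i
    fin_cases i <;> simp only [K3.skew, Pi.add_apply, Pi.smul_apply, smul_eq_mul, Fin.zero_eta,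
      Fin.mk_one, Matrix.cons_val_zero, Matrix.cons_val_one]
    · linear_combination z 0 * h
    · linear_combination z 1 * h
  right_inv z := by
    simp only [K3.skew] at h
    ext i
    fin_cases i <;> simp only [K3.skew, Pi.add_apply, Pi.smul_apply, smul_eq_mul, Fin.zero_eta,
      Fin.mk_one, Matrix.cons_val_zero, Matrix.cons_val_one]
    · linear_combination z 0 * h
    · linear_combination z 1 * h

theorem symplecticEquiv_apply {x y : Fin 2 → F} (h : K3.skew x y = 1) (z : Fin 2 → F) :
    symplecticEquiv h z = z 0 • x + z 1 • y := rfl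

theorem skew_symplecticEquiv {x y : Fin 2 → F} (h : K3.skew x y = 1) (z t : Fin 2 → F) :
    K3.skew (symplecticEquiv h z) (symplecticEquiv h t) = K3.skew z t := by
  rw [symplecticEquiv_apply, symplecticEquiv_apply]
  simp only [K3.skew, Pi.add_apply, Pi.smul_apply, smul_eq_mul] at h ⊢
  linear_combination (z 0 * t 1 - z 1 * t 0) * h

namespace Grading

open K10

variable {G : Type u} [CommGroup G] {Γ Γ' : Grading F G} {g₁ g₂ g h : G}
  {φ : K10 F ≃ₗ[F] K10 F}

/-- The preimage of a grading under an automorphism. -/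
def comap (Γ : Grading F G) (hφ : IsAut φ) : Grading F G where
  comp g := (Γ.comp g).comap φ.toLinearMap
  independent := Γ.independent.map_orderIso (Submodule.orderIsoMapComap φ).symm
  iSup_eq_top := by
    have h := (Submodule.orderIsoMapComap φ).symm.map_iSup Γ.comp
    rw [Γ.iSup_eq_top, map_top] at h
    exact h.symm
  mul_mem g h X hX Y hY := by
    rw [Submodule.mem_comap, LinearEquiv.coe_coe, hφ.1]
    exact Γ.mul_mem g h _ hX _ hY
  super g := by
    refine le_antisymm (fun X hX => ?_) (sup_le inf_le_left inf_le_left)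
    obtain ⟨E, hE, O, hO, hEO⟩ := Submodule.mem_sup.1 ((Γ.super g).le hX)
    have hX' : X = φ.symm E + φ.symm O := by rw [← map_add, hEO]; simp
    rw [hX']
    exact Submodule.add_mem_sup
      ⟨by simpa using hE.1, hφ.symm.apply_mem_evenPart hE.2⟩
      ⟨by simpa using hO.1, hφ.symm.apply_mem_oddPart hO.2⟩

theorem comap_iso (Γ : Grading F G) (hφ : IsAut φ) : (Γ.comap hφ).Iso Γ :=
  ⟨φ, hφ, fun _ => Submodule.map_comap_eq_of_surjective φ.surjective _⟩

theorem Iso.symm (h : Γ.Iso Γ') : Γ'.Iso Γ := by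
  obtain ⟨φ, hφ, hcomp⟩ := h
  refine ⟨φ.symm, hφ.symm, fun g => ?_⟩
  rw [← hcomp, ← Submodule.map_comp]
  simp

theorem Iso.trans {Γ'' : Grading F G} (h : Γ.Iso Γ') (h' : Γ'.Iso Γ'') : Γ.Iso Γ'' := by
  obtain ⟨φ, hφ, hcomp⟩ := h
  obtain ⟨ψ, hψ, hcomp'⟩ := h'
  refine ⟨φ.trans ψ, hφ.trans hψ, fun g => ?_⟩
  rw [← hcomp', ← hcomp, ← Submodule.map_comp]
  rfl

theorem mem_oddComp_comap_swap {m : OddVec F} :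
    m ∈ (Γ.comap swap_isAut).oddComp g ↔ m.swap ∈ Γ.oddComp g := by
  rw [mem_oddComp, mem_oddComp, ← swap_oddMap]
  rfl

theorem HasFlipDegree.comap_swap (hΓ : Γ.HasFlipDegree h) :
    (Γ.comap swap_isAut).HasFlipDegree h := by
  intro g m hm
  rw [mem_oddComp_comap_swap] at hm
  rw [Submodule.mem_comap, mem_oddComp_comap_swap]
  have hflip : (oddFlip m).swap = -oddFlip m.swap := by simp [oddFlip_apply]
  exact hflip ▸ neg_mem (hΓ g hm)

theorem IsGamma1.comap_swap (hΓ : Γ.IsGamma1 g₁ g₂) : (Γ.comap swap_isAut).IsGamma1 g₂ g₁ := by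
  refine isGamma1_iff.2 fun i => ?_
  have hbasis : (oddBasis1 F i).swap = oddBasis1 F (![2, 3, 0, 1] i) := by
    fin_cases i <;> simp [coe_oddBasis1]
  have hdeg : ![g₂, g₂⁻¹, g₁, g₁⁻¹] i = ![g₁, g₁⁻¹, g₂, g₂⁻¹] (![2, 3, 0, 1] i) := by
    fin_cases i <;> rfl
  rw [mem_oddComp_comap_swap, hbasis, hdeg]
  exact isGamma1_iff.1 hΓ _

theorem mem_oddComp_comap_tensorEquiv {A B : (Fin 2 → F) ≃ₗ[F] (Fin 2 → F)}
    (hAB : IsAut (tensorEquiv A B)) {m : OddVec F} :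
    m ∈ (Γ.comap hAB).oddComp g ↔ (A m.1, B m.2) ∈ Γ.oddComp g := by
  rw [mem_oddComp, mem_oddComp, ← tensorEquiv_oddMap]
  rfl

theorem exists_isGamma1_iso {x₁ y₁ x₂ y₂ : Fin 2 → F} (h₁ : K3.skew x₁ y₁ = 1)
    (h₂ : K3.skew x₂ y₂ = 1) (hx₁ : (x₁, 0) ∈ Γ.oddComp g₁) (hy₁ : (y₁, 0) ∈ Γ.oddComp g₁⁻¹)
    (hx₂ : (0, x₂) ∈ Γ.oddComp g₂) (hy₂ : (0, y₂) ∈ Γ.oddComp g₂⁻¹) :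
    ∃ Γ' : Grading F G, Γ'.IsGamma1 g₁ g₂ ∧ Γ.Iso Γ' := by
  have hφ := tensorEquiv_isAut (skew_symplecticEquiv h₁) (skew_symplecticEquiv h₂)
  refine ⟨Γ.comap hφ, isGamma1_iff.2 fun i => ?_, (Γ.comap_iso hφ).symm⟩
  rw [mem_oddComp_comap_tensorEquiv]
  fin_cases i <;> simpa [coe_oddBasis1, symplecticEquiv_apply]

theorem exists_isGamma2_iso (hF : (2 : F) ≠ 0) {x₁ y₁ x₂ y₂ : Fin 2 → F}
    (h₁ : K3.skew x₁ y₁ = 1) (h₂ : K3.skew x₂ y₂ = 1) (hx : (x₁, x₂) ∈ Γ.oddComp g)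
    (hy : (y₁, y₂) ∈ Γ.oddComp g⁻¹) (hx' : (x₁, -x₂) ∈ Γ.oddComp (g * h))
    (hy' : (y₁, -y₂) ∈ Γ.oddComp (g * h)⁻¹) :
    ∃ Γ' : Grading F G, Γ'.IsGamma2 g h ∧ Γ.Iso Γ' := by
  have hφ := tensorEquiv_isAut (skew_symplecticEquiv h₁) (skew_symplecticEquiv h₂)
  refine ⟨Γ.comap hφ, (isGamma2_iff hF).2 fun i => ?_, (Γ.comap_iso hφ).symm⟩
  rw [mem_oddComp_comap_tensorEquiv]
  fin_cases i <;> simpa [coe_oddBasis2, symplecticEquiv_apply, -mul_inv_rev]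

end Grading

end Transport

section Universal

theorem exists_hom_int_prod_int {G : Type u} [CommGroup G] (g₁ g₂ : G) :
    ∃ f : Multiplicative (ℤ × ℤ) →* G, f (.ofAdd (1, 0)) = g₁ ∧ f (.ofAdd (0, 1)) = g₂ := by
  refine ⟨((zmultiplesHom (Additive G) (.ofMul g₁)).coprod
    (zmultiplesHom (Additive G) (.ofMul g₂))).toMultiplicativeLeft, ?_, ?_⟩ <;> simp

theorem exists_hom_int_prod_zmod {G : Type u} [CommGroup G] {g h : G} {n : ℕ} (hh : h ^ n = 1) :
    ∃ f : Multiplicative (ℤ × ZMod n) →* G, f (.ofAdd (1, 0)) = g ∧ f (.ofAdd (0, 1)) = h := by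
  have hn : zmultiplesHom (Additive G) (.ofMul h) n = 0 := by simp [← ofMul_pow, hh]
  refine ⟨((zmultiplesHom (Additive G) (.ofMul g)).coprod
    (ZMod.lift n ⟨zmultiplesHom (Additive G) (.ofMul h), hn⟩)).toMultiplicativeLeft, ?_, ?_⟩
  · simp
  · have h1 : ZMod.lift n ⟨zmultiplesHom (Additive G) (.ofMul h), hn⟩ 1 = .ofMul h := by
      simpa using ZMod.lift_coe n ⟨zmultiplesHom (Additive G) (.ofMul h), hn⟩ 1
    simp [h1]

namespace Grading

open K10

variable {G : Type u} [CommGroup G] {A : Type u} [AddCommGroup A]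

theorem IsGamma1.comp_le_comap_swap (hF : (2 : F) ≠ 0) {Γ : Grading F G} {g : G}
    (hΓ : Γ.IsGamma1 g g) (k : G) : Γ.comp k ≤ (Γ.comp k).comap (swap F).toLinearMap :=
  (congrFun (congrArg comp (hΓ.comap_swap.eq hF hΓ)) k).ge

theorem IsGamma1.isGamma2_split (hF : (2 : F) ≠ 0) {Γ : Grading F (Multiplicative A)} {x : A}
    (hΓ : Γ.IsGamma1 (.ofAdd x) (.ofAdd x)) :
    (split hF Γ swap_isAut swapHom_swapHom (hΓ.comp_le_comap_swap hF)).IsGamma2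
      (.ofAdd (x, 0)) (.ofAdd (0, 1)) := by
  have hmem (k : A) (z : Fin 2 → F) (h₁ : (z, 0) ∈ Γ.oddComp (.ofAdd k))
      (h₂ : (0, z) ∈ Γ.oddComp (.ofAdd k)) :
      oddMap F (z, z) ∈ Γ.splitComp (swap F) (.ofAdd (k, 0)) ∧
        oddMap F (z, -z) ∈ Γ.splitComp (swap F) (.ofAdd (k, 1)) := by
    have hadd := add_mem h₁ h₂
    have hsub := sub_mem h₁ h₂
    refine ⟨mem_splitComp.2 ⟨?_, ?_⟩, mem_splitComp.2 ⟨?_, ?_⟩⟩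
    · simpa [mem_oddComp] using hadd
    · simp [swap_oddMap]
    · simpa [mem_oddComp] using hsub
    · simp [swap_oddMap, ← map_neg]
  have h := isGamma1_iff.1 hΓ
  simp only [Fin.forall_fin_succ, coe_oddBasis1] at h
  have hu := hmem x ![1, 0] h.1 h.2.2.1
  have hv := hmem (-x) ![0, 1] h.2.1 h.2.2.2.1
  refine (isGamma2_iff hF).2 fun i => ?_
  have hdeg : ![.ofAdd (x, 0), (.ofAdd (x, 0))⁻¹, .ofAdd (x, 0) * .ofAdd (0, 1),
      (.ofAdd (x, 0) * .ofAdd (0, 1))⁻¹] i =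
      (![.ofAdd (x, 0), .ofAdd (-x, 0), .ofAdd (x, 1), .ofAdd (-x, 1)] i :
        Multiplicative (A × ZMod 2)) := by
    fin_cases i <;> simp [← ofAdd_neg, ← ofAdd_add]
  rw [coe_oddBasis2, hdeg]
  fin_cases i
  exacts [hu.1, hv.1, hu.2, hv.2]

theorem isGamma1_coarsen_universal1 : ((universal1 F).coarsen
    ((AddMonoidHom.fst ℤ ℤ + AddMonoidHom.snd ℤ ℤ).toMultiplicative)).IsGamma1
      (.ofAdd 1) (.ofAdd 1) := by
  simpa using isGamma1_universal1.coarsen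
    ((AddMonoidHom.fst ℤ ℤ + AddMonoidHom.snd ℤ ℤ).toMultiplicative)

/-- The grading `Γ²(ℤ × ℤ/2; (1, 0), (0, 1))`, which splits the coarsening `Γ¹(ℤ; 1, 1)` of
`universal1 F` by the exchange automorphism. -/
def universal2 (hF : (2 : F) ≠ 0) : Grading F (Multiplicative (ℤ × ZMod 2)) :=
  split hF _ swap_isAut swapHom_swapHom (isGamma1_coarsen_universal1.comp_le_comap_swap hF)

theorem isGamma2_universal2 (hF : (2 : F) ≠ 0) :
    (universal2 hF).IsGamma2 (.ofAdd (1, 0)) (.ofAdd (0, 1)) :=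
  isGamma1_coarsen_universal1.isGamma2_split hF

theorem existsUnique_isGamma1 (hF : (2 : F) ≠ 0) (g₁ g₂ : G) :
    ∃! Γ : Grading F G, Γ.IsGamma1 g₁ g₂ := by
  obtain ⟨f, rfl, rfl⟩ := exists_hom_int_prod_int g₁ g₂
  exact ⟨_, isGamma1_universal1.coarsen f, fun _ hΓ => hΓ.eq hF (isGamma1_universal1.coarsen f)⟩

theorem existsUnique_isGamma2 (hF : (2 : F) ≠ 0) (g : G) {h : G} (hh : h ^ 2 = 1) :
    ∃! Γ : Grading F G, Γ.IsGamma2 g h := by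
  obtain ⟨f, rfl, rfl⟩ := exists_hom_int_prod_zmod (g := g) hh
  have hΓ := (isGamma2_universal2 hF).coarsen f
  exact ⟨_, hΓ, fun _ hΓ' => hΓ'.eq hF hΓ⟩

end Grading

end Universal

section Classification

namespace Grading

open K10

variable {G : Type u} [CommGroup G] {Γ : Grading F G} {g k l : G} {m n p : OddVec F}

theorem oddTriple_mem (hF : (2 : F) ≠ 0) (hm : m ∈ Γ.oddComp g) (hn : n ∈ Γ.oddComp k)
    (hp : p ∈ Γ.oddComp l) : oddTriple m n p ∈ Γ.oddComp (g * k * l) := by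
  rw [mem_oddComp, ← mul_mul_oddMap hF]
  exact Submodule.smul_mem _ _ (Γ.mul_mem _ _ _ (Γ.mul_mem _ _ _ hm _ hn) _ hp)

theorem oddForm_eq_zero (hF : (2 : F) ≠ 0) (hm : m ∈ Γ.oddComp g) (hn : n ∈ Γ.oddComp k)
    (hgk : g * k ≠ 1) : oddForm m n = 0 := by
  classical
  have htrace : LinearMap.trace F (OddVec F) (oddTriple m n) = 0 :=
    LinearMap.trace_eq_zero_of_mapsTo_ne (DirectSum.isInternal_submodule_of_iSupIndep_of_iSup_eq_top
      iSupIndep_oddComp (iSup_oddComp (Γ := Γ) hF)) (g * k * ·) (fun _ => by simpa)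
      (fun _ _ hp => oddTriple_mem hF hm hn hp)
  have h4 : (4 : F) ≠ 0 := by
    rw [show (4 : F) = 2 * 2 by norm_num]
    exact mul_ne_zero hF hF
  exact (mul_eq_zero.1 (trace_oddTriple m n ▸ htrace)).resolve_left h4

theorem exists_oddForm_eq_one (hF : (2 : F) ≠ 0) (hm : m ∈ Γ.oddComp g) (hm0 : m ≠ 0) :
    ∃ n ∈ Γ.oddComp g⁻¹, oddForm m n = 1 := by
  obtain ⟨n, hn, hmn⟩ : ∃ n ∈ Γ.oddComp g⁻¹, oddForm m n ≠ 0 := by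
    by_contra! hzero
    refine hm0 (separatingLeft_oddForm m fun n => ?_)
    refine Γ.mem_of_oddComp_le hF (S := LinearMap.ker (oddForm m)) (fun k n hn => ?_) n
    rcases eq_or_ne k g⁻¹ with rfl | hk
    · exact hzero n hn
    · exact oddForm_eq_zero hF hm hn (by rwa [Ne, mul_eq_one_iff_inv_eq, eq_comm])
  exact ⟨(oddForm m n)⁻¹ • n, Submodule.smul_mem _ _ hn, by simp [hmn]⟩

theorem oddForm_smul_mem (hF : (2 : F) ≠ 0) (hm : m ∈ Γ.oddComp g) (hn : n ∈ Γ.oddComp k)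
    (hp : p ∈ Γ.oddComp l) : oddForm m n • p ∈ Γ.oddComp (g * k * l) := by
  by_cases hgk : g * k = 1
  · rw [hgk, one_mul]
    exact Submodule.smul_mem _ _ hp
  · rw [oddForm_eq_zero hF hm hn hgk, zero_smul]
    exact zero_mem _

theorem oddFlip_mem_of_oddForm_ne_zero (hF : (2 : F) ≠ 0) (hm : m ∈ Γ.oddComp g)
    (hn : n ∈ Γ.oddComp k) (hmn : oddForm (oddFlip m) n ≠ 0) :
    oddFlip m ∈ Γ.oddComp (g * k * g) := by
  have hmem : oddForm (oddFlip m) m • oddFlip n - oddForm (oddFlip n) m • oddFlip m ∈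
      Γ.oddComp (g * k * g) := by
    rw [oddForm_oddFlip_smul_sub, oddForm_self, zero_smul, add_zero, mul_smul]
    refine sub_mem (sub_mem (Submodule.smul_mem _ _ (oddTriple_mem hF hm hn hm))
      (Submodule.smul_mem _ _ (oddForm_smul_mem hF hm hn hm))) ?_
    rw [mul_comm g k]
    exact oddForm_smul_mem hF hn hm hm
  have hmm : oddForm (oddFlip m) m = 0 := by
    simp only [oddForm_apply, oddFlip_apply, K3.skew, Pi.neg_apply]; ring
  have hnm : oddForm (oddFlip n) m = -oddForm (oddFlip m) n := by
    simp only [oddForm_apply, oddFlip_apply, K3.skew, Pi.neg_apply]; ring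
  rwa [hmm, hnm, zero_smul, neg_smul, zero_sub, neg_neg, Submodule.smul_mem_iff _ hmn] at hmem

theorem exists_oddFlip_mem (hF : (2 : F) ≠ 0) (hm : m ∈ Γ.oddComp g) :
    ∃ h, h ^ 2 = 1 ∧ oddFlip m ∈ Γ.oddComp (g * h) := by
  by_cases hm0 : oddFlip m = 0
  · exact ⟨1, one_pow 2, hm0 ▸ zero_mem _⟩
  obtain ⟨k, hk⟩ : ∃ k, oddFlip m ∈ Γ.oddComp k := by
    by_contra! hmem
    refine hm0 (separatingLeft_oddForm _ fun n => ?_)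
    refine Γ.mem_of_oddComp_le hF (S := LinearMap.ker (oddForm (oddFlip m))) (fun k n hn => ?_) n
    by_contra hmn
    exact hmem _ (oddFlip_mem_of_oddForm_ne_zero hF hm hn hmn)
  obtain ⟨n, hn, hmn⟩ := exists_oddForm_eq_one hF hk hm0
  have hk' : k = g * k⁻¹ * g := by
    by_contra hne
    exact hm0 (eq_zero_of_mem_of_mem (A := Γ.oddComp) iSupIndep_oddComp hne hk
      (oddFlip_mem_of_oddForm_ne_zero hF hm hn (hmn ▸ one_ne_zero)))
  refine ⟨g⁻¹ * k, ?_, by rwa [mul_inv_cancel_left]⟩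
  rw [sq]
  nth_rw 1 [hk']
  group

theorem HasFlipDegree.exists_symplectic_fst (hF : (2 : F) ≠ 0) (hΓ : Γ.HasFlipDegree 1) :
    ∃ (g : G) (x y : Fin 2 → F), K3.skew x y = 1 ∧ (x, 0) ∈ Γ.oddComp g ∧
      (y, 0) ∈ Γ.oddComp g⁻¹ := by
  have hfst {g : G} {m : OddVec F} (hm : m ∈ Γ.oddComp g) : (m.1, 0) ∈ Γ.oddComp g := by
    have hflip : oddFlip m ∈ Γ.oddComp g := mul_one g ▸ hΓ g hm
    have h2 : (2 : F) • ((m.1, 0) : OddVec F) = m + oddFlip m := by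
      simp [oddFlip_apply, Prod.ext_iff, two_smul]
    rw [← Submodule.smul_mem_iff _ hF, h2]
    exact add_mem hm hflip
  obtain ⟨g, x, hx, hx0⟩ : ∃ g, ∃ x : Fin 2 → F, (x, 0) ∈ Γ.oddComp g ∧ x ≠ 0 := by
    by_contra! hzero
    have h := Γ.mem_of_oddComp_le hF (S := LinearMap.ker (LinearMap.fst F _ _))
      (fun g m hm => hzero g m.1 (hfst hm)) (![1, 0], 0)
    simp at h
  obtain ⟨n, hn, hxn⟩ := exists_oddForm_eq_one hF hx (by simpa [Prod.ext_iff])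
  exact ⟨g, x, n.1, by simpa [oddForm_apply, K3.skew] using hxn, hx, hfst hn⟩

theorem HasFlipDegree.exists_isGamma1 (hF : (2 : F) ≠ 0) (hΓ : Γ.HasFlipDegree 1) :
    ∃ (g₁ g₂ : G) (Γ' : Grading F G), Γ'.IsGamma1 g₁ g₂ ∧ Γ.Iso Γ' := by
  obtain ⟨g₁, x₁, y₁, h₁, hx₁, hy₁⟩ := hΓ.exists_symplectic_fst hF
  obtain ⟨g₂, x₂, y₂, h₂, hx₂, hy₂⟩ := hΓ.comap_swap.exists_symplectic_fst hF
  rw [mem_oddComp_comap_swap] at hx₂ hy₂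
  exact ⟨g₁, g₂, exists_isGamma1_iso h₁ h₂ hx₁ hy₁ hx₂ hy₂⟩

theorem exists_isGamma2_of_not_hasFlipDegree (hF : (2 : F) ≠ 0) (hΓ : ¬Γ.HasFlipDegree 1) :
    ∃ (g h : G) (Γ' : Grading F G), h ^ 2 = 1 ∧ h ≠ 1 ∧ Γ'.IsGamma2 g h ∧ Γ.Iso Γ' := by
  obtain ⟨g, m, hm, hflip⟩ : ∃ g, ∃ m ∈ Γ.oddComp g, oddFlip m ∉ Γ.oddComp g := by
    simpa [HasFlipDegree, SetLike.not_le_iff_exists] using hΓ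
  obtain ⟨h, hh, hmh⟩ := exists_oddFlip_mem hF hm
  have hh1 : h ≠ 1 := by
    rintro rfl
    exact hflip (mul_one g ▸ hmh)
  obtain ⟨n, hn, hmn⟩ := exists_oddForm_eq_one hF hm (by rintro rfl; simp at hflip)
  obtain ⟨h', -, hnh'⟩ := exists_oddFlip_mem hF hn
  have hflips : oddForm (oddFlip m) (oddFlip n) = 1 := by
    rw [← hmn]
    simp only [oddForm_apply, oddFlip_apply, K3.skew, Pi.neg_apply]; ring
  have hdeg : g⁻¹ * h' = (g * h)⁻¹ := by
    refine (inv_eq_of_mul_eq_one_right ?_).symm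
    by_contra hne
    exact one_ne_zero (hflips.symm.trans (oddForm_eq_zero hF hmh hnh' hne))
  rw [hdeg] at hnh'
  have hzero : oddForm m (oddFlip n) = 0 := oddForm_eq_zero hF hm hnh' (by simpa using hh1)
  simp only [oddForm_apply, oddFlip_apply, K3.skew, Pi.neg_apply] at hmn hzero
  have h₁ : K3.skew m.1 ((2 : F) • n.1) = 1 := by
    simp only [K3.skew, Pi.smul_apply, smul_eq_mul]; linear_combination hmn + hzero
  have h₂ : K3.skew m.2 ((2 : F) • n.2) = 1 := by
    simp only [K3.skew, Pi.smul_apply, smul_eq_mul]; linear_combination hmn - hzero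
  refine ⟨g, h, (exists_isGamma2_iso hF h₁ h₂ hm (Submodule.smul_mem _ (2 : F) hn) hmh ?_).imp
    fun _ hΓ' => ⟨hh, hh1, hΓ'⟩⟩
  simpa [oddFlip_apply] using Submodule.smul_mem _ (2 : F) hnh'

theorem exists_isGamma1_or_isGamma2 (hF : (2 : F) ≠ 0) (Γ : Grading F G) :
    (∃ (g₁ g₂ : G) (Γ' : Grading F G), Γ'.IsGamma1 g₁ g₂ ∧ Γ.Iso Γ') ∨
      ∃ (g h : G) (Γ' : Grading F G), h ^ 2 = 1 ∧ h ≠ 1 ∧ Γ'.IsGamma2 g h ∧ Γ.Iso Γ' :=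
  (em (Γ.HasFlipDegree 1)).imp (HasFlipDegree.exists_isGamma1 hF)
    (exists_isGamma2_of_not_hasFlipDegree hF)

end Grading

end Classification

section IsoCriteria

theorem exists_symplectic_of_eq_or_eq_inv {G : Type u} [Group G]
    {P : G → Submodule F (Fin 2 → F)} {g g' : G} (hx : ![1, 0] ∈ P g) (hy : ![0, 1] ∈ P g⁻¹)
    (hg : g' = g ∨ g' = g⁻¹) : ∃ x y, K3.skew x y = 1 ∧ x ∈ P g' ∧ y ∈ P g'⁻¹ := by
  rcases hg with rfl | rfl
  · exact ⟨![1, 0], ![0, 1], by simp [K3.skew], hx, hy⟩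
  · exact ⟨![0, 1], -![1, 0], by simp [K3.skew], hy, neg_mem (by rwa [inv_inv])⟩

namespace Grading

open K10

variable {G : Type u} [CommGroup G] {Γ Γ' : Grading F G} {g₁ g₂ g₁' g₂' g h g' h' : G}

theorem Iso.oddComp_ne_bot (hiso : Γ.Iso Γ') (hg : Γ.oddComp g ≠ ⊥) : Γ'.oddComp g ≠ ⊥ := by
  obtain ⟨φ, hφ, hcomp⟩ := hiso
  obtain ⟨ψ, hψ⟩ := hφ.exists_oddEquiv
  refine fun hbot => hg (eq_bot_iff.2 fun m hm => ?_)
  have hm' : ψ m ∈ Γ'.oddComp g := by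
    rw [mem_oddComp, ← hψ, ← hcomp]
    exact Submodule.mem_map_of_mem hm
  simpa [hbot] using hm'

theorem IsGamma1.oddComp_ne_bot_iff (hΓ : Γ.IsGamma1 g₁ g₂) :
    Γ.oddComp g ≠ ⊥ ↔ g ∈ ({g₁, g₁⁻¹, g₂, g₂⁻¹} : Set G) := by
  rw [hΓ.oddComp_eq, homogeneousSpan_ne_bot]
  simp only [Matrix.range_cons, Matrix.range_empty, Set.union_empty, Set.singleton_union]

theorem IsGamma2.oddComp_ne_bot_iff (hF : (2 : F) ≠ 0) (hΓ : Γ.IsGamma2 g h) :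
    Γ.oddComp g' ≠ ⊥ ↔ g' ∈ ({g, g⁻¹, g * h, (g * h)⁻¹} : Set G) := by
  rw [hΓ.oddComp_eq hF, homogeneousSpan_ne_bot]
  simp only [Matrix.range_cons, Matrix.range_empty, Set.union_empty, Set.singleton_union]

theorem IsGamma1.iso_of_eq_or_eq_inv (hF : (2 : F) ≠ 0) (hΓ : Γ.IsGamma1 g₁ g₂)
    (hΓ' : Γ'.IsGamma1 g₁' g₂') (h₁ : g₁' = g₁ ∨ g₁' = g₁⁻¹) (h₂ : g₂' = g₂ ∨ g₂' = g₂⁻¹) :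
    Γ.Iso Γ' := by
  have h := isGamma1_iff.1 hΓ
  simp only [Fin.forall_fin_succ, coe_oddBasis1] at h
  obtain ⟨x₁, y₁, hxy₁, hx₁, hy₁⟩ := exists_symplectic_of_eq_or_eq_inv
    (P := fun g => (Γ.oddComp g).comap (LinearMap.inl F _ _)) h.1 h.2.1 h₁
  obtain ⟨x₂, y₂, hxy₂, hx₂, hy₂⟩ := exists_symplectic_of_eq_or_eq_inv
    (P := fun g => (Γ.oddComp g).comap (LinearMap.inr F _ _)) h.2.2.1 h.2.2.2.1 h₂
  obtain ⟨Γ'', hΓ'', hiso⟩ := exists_isGamma1_iso hxy₁ hxy₂ hx₁ hy₁ hx₂ hy₂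
  exact hΓ''.eq hF hΓ' ▸ hiso

theorem IsGamma1.iso_iff (hF : (2 : F) ≠ 0) (hΓ : Γ.IsGamma1 g₁ g₂) (hΓ' : Γ'.IsGamma1 g₁' g₂') :
    Γ.Iso Γ' ↔ ({g₁, g₁⁻¹, g₂, g₂⁻¹} : Set G) = {g₁', g₁'⁻¹, g₂', g₂'⁻¹} := by
  refine ⟨fun hiso => ?_, fun hset => ?_⟩
  · ext g
    rw [← hΓ.oddComp_ne_bot_iff, ← hΓ'.oddComp_ne_bot_iff]
    exact ⟨hiso.oddComp_ne_bot, hiso.symm.oddComp_ne_bot⟩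
  · have hcases : ((g₁' = g₁ ∨ g₁' = g₁⁻¹) ∧ (g₂' = g₂ ∨ g₂' = g₂⁻¹)) ∨
        ((g₁' = g₂ ∨ g₁' = g₂⁻¹) ∧ (g₂' = g₁ ∨ g₂' = g₁⁻¹)) := by
      have h₁ : g₁' ∈ ({g₁, g₁⁻¹, g₂, g₂⁻¹} : Set G) := by rw [hset]; simp
      have h₂ : g₂' ∈ ({g₁, g₁⁻¹, g₂, g₂⁻¹} : Set G) := by rw [hset]; simp
      have h₁' : g₁ ∈ ({g₁', g₁'⁻¹, g₂', g₂'⁻¹} : Set G) := by rw [← hset]; simp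
      have h₂' : g₂ ∈ ({g₁', g₁'⁻¹, g₂', g₂'⁻¹} : Set G) := by rw [← hset]; simp
      simp only [Set.mem_insert_iff, Set.mem_singleton_iff] at h₁ h₂ h₁' h₂'
      grind [inv_inv g₁, inv_inv g₂, inv_inv g₁', inv_inv g₂']
    rcases hcases with ⟨h₁, h₂⟩ | ⟨h₁, h₂⟩
    · exact hΓ.iso_of_eq_or_eq_inv hF hΓ' h₁ h₂
    · exact (Γ.comap_iso swap_isAut).symm.trans (hΓ.comap_swap.iso_of_eq_or_eq_inv hF hΓ' h₁ h₂)

theorem IsGamma1.not_iso (hF : (2 : F) ≠ 0) (hΓ : Γ.IsGamma1 g₁ g₂) (hΓ' : Γ'.IsGamma2 g h)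
    (hh : h ^ 2 = 1) (hh1 : h ≠ 1) : ¬Γ.Iso Γ' := fun hiso =>
  hh1 (hΓ.hasFlipDegree.eq_of_iso hF (hΓ'.hasFlipDegree hF hh) hiso).symm

theorem IsGamma2.iso_of_eq_or_eq_inv (hF : (2 : F) ≠ 0) (hΓ : Γ.IsGamma2 g h)
    (hΓ' : Γ'.IsGamma2 g' h) (hh : h ^ 2 = 1) (hg : g' = g ∨ g' = g⁻¹) : Γ.Iso Γ' := by
  have hinv (k : G) : (k * h)⁻¹ = k⁻¹ * h := by
    rw [mul_inv, inv_eq_of_mul_eq_one_right (a := h) (sq h ▸ hh)]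
  have hbasis := (isGamma2_iff hF).1 hΓ
  simp only [Fin.forall_fin_succ, coe_oddBasis2] at hbasis
  obtain ⟨x, y, hxy, hx, hy⟩ := exists_symplectic_of_eq_or_eq_inv
    (P := fun g => (Γ.oddComp g).comap (LinearMap.id.prod LinearMap.id) ⊓
      (Γ.oddComp (g * h)).comap (LinearMap.id.prod (-LinearMap.id)))
    ⟨hbasis.1, hbasis.2.2.1⟩ ⟨hbasis.2.1, hinv g ▸ hbasis.2.2.2.1⟩ hg
  obtain ⟨Γ'', hΓ'', hiso⟩ := exists_isGamma2_iso (h := h) hF hxy hxy hx.1 hy.1 hx.2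
    (hinv g' ▸ hy.2)
  exact hΓ''.eq hF hΓ' ▸ hiso

theorem IsGamma2.exists_isGamma2_mul_iso (hF : (2 : F) ≠ 0) (hΓ : Γ.IsGamma2 g h)
    (hh : h ^ 2 = 1) : ∃ Γ' : Grading F G, Γ'.IsGamma2 (g * h) h ∧ Γ.Iso Γ' := by
  have hghh : g * h * h = g := by rw [mul_assoc, ← sq, hh, mul_one]
  have hbasis := (isGamma2_iff hF).1 hΓ
  simp only [Fin.forall_fin_succ, coe_oddBasis2] at hbasis
  refine exists_isGamma2_iso (h := h) hF (x₁ := ![1, 0]) (y₁ := ![0, 1]) (x₂ := -![1, 0])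
    (y₂ := -![0, 1]) (by simp [K3.skew]) (by simp [K3.skew]) hbasis.2.2.1 hbasis.2.2.2.1 ?_ ?_
  · rw [hghh, neg_neg]
    exact hbasis.1
  · rw [hghh, neg_neg]
    exact hbasis.2.1

theorem IsGamma2.iso_iff (hF : (2 : F) ≠ 0) (hΓ : Γ.IsGamma2 g h) (hh : h ^ 2 = 1)
    (hΓ' : Γ'.IsGamma2 g' h') (hh' : h' ^ 2 = 1) :
    Γ.Iso Γ' ↔ h' = h ∧ g' ∈ ({g, g * h, g⁻¹, g⁻¹ * h} : Set G) := by
  have hset : ({g, g * h, g⁻¹, g⁻¹ * h} : Set G) = {g, g⁻¹, g * h, (g * h)⁻¹} := by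
    rw [mul_inv, inv_eq_of_mul_eq_one_right (a := h) (sq h ▸ hh), Set.insert_comm (g * h)]
  rw [hset]
  refine ⟨fun hiso => ⟨?_, ?_⟩, ?_⟩
  · exact ((hΓ.hasFlipDegree hF hh).eq_of_iso hF (hΓ'.hasFlipDegree hF hh') hiso).symm
  · rw [← hΓ.oddComp_ne_bot_iff hF]
    exact hiso.symm.oddComp_ne_bot ((hΓ'.oddComp_ne_bot_iff hF).2 (Set.mem_insert _ _))
  · rintro ⟨rfl, hg | hg | hg⟩
    · exact hΓ.iso_of_eq_or_eq_inv hF hΓ' hh (Or.inl hg)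
    · exact hΓ.iso_of_eq_or_eq_inv hF hΓ' hh (Or.inr hg)
    · obtain ⟨Γ'', hΓ'', hiso⟩ := hΓ.exists_isGamma2_mul_iso hF hh
      exact hiso.trans (hΓ''.iso_of_eq_or_eq_inv hF hΓ' hh hg)

end Grading

end IsoCriteria

section FineGradings

namespace Grading

open K10

variable {G : Type u} [CommGroup G] {H : Type v} [CommGroup H]
  {Γ Γ' : Grading F G} {Θ : Grading F H}

theorem exists_basis_mem_oddComp (hF : (2 : F) ≠ 0) {ι : Type*}
    {b : Module.Basis ι F (OddVec F)} {d : ι → G} (hd : Function.Injective d)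
    (hΓ : Γ.oddComp = homogeneousSpan b d) (hle : ∀ h, ∃ g, Θ.comp h ≤ Γ.comp g) (i : ι) :
    ∃ k, b i ∈ Θ.oddComp k := by
  by_contra! hnot
  have hker (k : H) : Θ.oddComp k ≤ LinearMap.ker (b.coord i) := by
    intro m hm
    obtain ⟨g, hg⟩ := hle k
    have hmg : m ∈ homogeneousSpan b d g := hΓ ▸ hg hm
    by_cases hi : d i = g
    · rw [← hi, homogeneousSpan_eq_span_singleton hd] at hmg
      obtain ⟨c, rfl⟩ := Submodule.mem_span_singleton.1 hmg
      obtain rfl : c = 0 := by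
        by_contra hc
        exact hnot k ((Submodule.smul_mem_iff _ hc).1 hm)
      simp
    · refine homogeneousSpan_le.2 (fun j hj => ?_) hmg
      have hji : j ≠ i := by
        rintro rfl
        exact hi hj
      simp [hji]
  have hi := Θ.mem_of_oddComp_le hF hker (b i)
  simp at hi

theorem mem_oddComp_inv_of_oddForm_ne_zero (hF : (2 : F) ≠ 0) {g k : G} {m n : OddVec F}
    (hm : m ∈ Γ.oddComp g) (hn : n ∈ Γ.oddComp k) (hmn : oddForm m n ≠ 0) :
    n ∈ Γ.oddComp g⁻¹ := by
  have hk : g⁻¹ = k := by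
    by_contra hne
    exact hmn (oddForm_eq_zero hF hm hn (by rwa [Ne, mul_eq_one_iff_inv_eq]))
  rwa [hk]

theorem IsGamma1.exists_isGamma1_of_refines (hF : (2 : F) ≠ 0) {g₁ g₂ : G}
    (hΓ : Γ.IsGamma1 g₁ g₂) (hd : Function.Injective ![g₁, g₁⁻¹, g₂, g₂⁻¹])
    (hle : ∀ h, ∃ g, Θ.comp h ≤ Γ.comp g) : ∃ h₁ h₂, Θ.IsGamma1 h₁ h₂ := by
  choose k hk using exists_basis_mem_oddComp hF hd hΓ.oddComp_eq hle
  refine ⟨k 0, k 2, isGamma1_iff.2 fun i => ?_⟩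
  fin_cases i
  · exact hk 0
  · exact mem_oddComp_inv_of_oddForm_ne_zero hF (hk 0) (hk 1)
      (by simp [coe_oddBasis1, oddForm_apply, K3.skew])
  · exact hk 2
  · exact mem_oddComp_inv_of_oddForm_ne_zero hF (hk 2) (hk 3)
      (by simp [coe_oddBasis1, oddForm_apply, K3.skew])

theorem IsGamma2.exists_isGamma2_of_refines (hF : (2 : F) ≠ 0) {g h : G}
    (hΓ : Γ.IsGamma2 g h) (hd : Function.Injective ![g, g⁻¹, g * h, (g * h)⁻¹])
    (hle : ∀ h, ∃ g, Θ.comp h ≤ Γ.comp g) : ∃ g' h', h' ^ 2 = 1 ∧ Θ.IsGamma2 g' h' := by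
  choose k hk using exists_basis_mem_oddComp hF hd (hΓ.oddComp_eq hF) hle
  obtain ⟨h', hh', hflip⟩ := exists_oddFlip_mem hF (hk 0)
  have hk2 : oddBasis2 hF 2 ∈ Θ.oddComp (k 0 * h') := by
    simpa [coe_oddBasis2, oddFlip_apply] using hflip
  refine ⟨k 0, h', hh', (isGamma2_iff hF).2 fun i => ?_⟩
  fin_cases i
  · exact hk 0
  · exact mem_oddComp_inv_of_oddForm_ne_zero hF (hk 0) (hk 1)
      (by simpa [coe_oddBasis2, oddForm_apply, K3.skew, one_add_one_eq_two])
  · exact hk2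
  · exact mem_oddComp_inv_of_oddForm_ne_zero hF hk2 (hk 3)
      (by simpa [coe_oddBasis2, oddForm_apply, K3.skew, one_add_one_eq_two])

theorem not_isProperRefinement_coarsen (Γ : Grading F G) (f : G →* H) :
    ¬(Γ.coarsen f).IsProperRefinement Γ := by
  rintro ⟨-, h, hh, g, hlt⟩
  refine hh (eq_bot_iff.2 fun X hX => ?_)
  by_contra hX0
  have hhg : h = f g := by
    by_contra hne
    exact hX0 (eq_zero_of_mem_of_mem (Γ.coarsen f).independent hne hX
      (Γ.comp_le_coarsen f g (hlt.le hX)))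
  exact hlt.not_ge (hhg ▸ Γ.comp_le_coarsen f g)

theorem IsGamma1.eq_coarsen (hF : (2 : F) ≠ 0) {g₁ g₂ : G} (hΓ : Γ.IsGamma1 g₁ g₂) :
    ∃ f, Γ = (universal1 F).coarsen f := by
  obtain ⟨f, rfl, rfl⟩ := exists_hom_int_prod_int g₁ g₂
  exact ⟨f, hΓ.eq hF (isGamma1_universal1.coarsen f)⟩

theorem IsGamma2.eq_coarsen (hF : (2 : F) ≠ 0) {g h : G} (hΓ : Γ.IsGamma2 g h)
    (hh : h ^ 2 = 1) : ∃ f, Γ = (universal2 hF).coarsen f := by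
  obtain ⟨f, rfl, rfl⟩ := exists_hom_int_prod_zmod (g := g) hh
  exact ⟨f, hΓ.eq hF ((isGamma2_universal2 hF).coarsen f)⟩

theorem isFine_universal1 (hF : (2 : F) ≠ 0) : IsFine.{v} (universal1 F) := by
  intro H _ Θ hΘ
  obtain ⟨_, _, h⟩ := isGamma1_universal1.exists_isGamma1_of_refines hF (by decide) hΘ.1
  obtain ⟨f, rfl⟩ := h.eq_coarsen hF
  exact not_isProperRefinement_coarsen _ f hΘ

theorem isFine_universal2 (hF : (2 : F) ≠ 0) : IsFine.{v} (universal2 hF) := by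
  intro H _ Θ hΘ
  obtain ⟨_, _, hh, h⟩ :=
    (isGamma2_universal2 hF).exists_isGamma2_of_refines hF (by decide) hΘ.1
  obtain ⟨f, rfl⟩ := h.eq_coarsen hF hh
  exact not_isProperRefinement_coarsen _ f hΘ

theorem not_equivalent_universal (hF : (2 : F) ≠ 0) :
    ¬(universal1 F).Equivalent (universal2 hF) := by
  intro hequiv
  have h := isGamma1_universal1.hasFlipDegree.eq_one_of_equivalent hF
    ((isGamma2_universal2 hF).hasFlipDegree hF rfl) hequiv
  revert h
  decide

theorem IsFine.of_iso (hΓ : IsFine.{v} Γ) (hiso : Γ.Iso Γ') : IsFine.{v} Γ' := by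
  rintro H _ Θ ⟨hle, h, hh, g, hlt⟩
  obtain ⟨φ, hφ, hcomp⟩ := hiso
  have hcomap (g : G) : Γ.comp g = (Γ'.comp g).comap φ.toLinearMap := by
    rw [← hcomp, Submodule.comap_map_eq_of_injective φ.injective]
  refine hΓ H (Θ.comap hφ) ⟨fun h => ?_, h, ?_, g, ?_⟩
  · obtain ⟨g, hg⟩ := hle h
    exact ⟨g, hcomap g ▸ Submodule.comap_mono hg⟩
  · exact fun hbot => hh ((map_eq_bot_iff (Submodule.orderIsoMapComap φ).symm).1 hbot)
  · rw [hcomap]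
    exact (Submodule.orderIsoMapComap φ).symm.lt_iff_lt.2 hlt

theorem Iso.trans_equivalent (hiso : Γ.Iso Γ') (hequiv : Γ'.Equivalent Θ) : Γ.Equivalent Θ := by
  obtain ⟨φ, hφ, hcomp⟩ := hiso
  obtain ⟨ψ, hψ, hcomp'⟩ := hequiv
  refine ⟨φ.trans ψ, hφ.trans hψ, fun g hg => ?_⟩
  obtain ⟨h, hh, hgh⟩ := hcomp' g fun hbot => hg <| by
    rwa [← hcomp, Submodule.map_eq_bot_iff] at hbot
  exact ⟨h, hh, by rw [← hgh, ← hcomp, ← Submodule.map_comp]; rfl⟩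

theorem IsFine.equivalent_of_coarsen {A : Type} [CommGroup A] {Λ : Grading F A} {f : A →* G}
    (hfine : IsFine.{v} (Λ.coarsen f)) : (Λ.coarsen f).Equivalent Λ := by
  let e : A ≃* ULift.{v} A := MulEquiv.ulift.symm
  have he (a : A) : (Λ.coarsen e.toMonoidHom).comp (e a) = Λ.comp a :=
    Λ.coarsen_comp_of_injective e.injective a
  have heq {a : A} (ha : Λ.comp a ≠ ⊥) : Λ.comp a = (Λ.coarsen f).comp (f a) := by
    by_contra hne
    refine hfine _ (Λ.coarsen e.toMonoidHom) ⟨fun h => ⟨f (e.symm h), ?_⟩, e a, ?_, f a, ?_⟩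
    · rw [← e.apply_symm_apply h, he, e.symm_apply_apply]
      exact Λ.comp_le_coarsen f _
    · rwa [support, Set.mem_ofPred_eq, he]
    · rw [he]
      exact lt_of_le_of_ne (Λ.comp_le_coarsen f a) hne
  refine ⟨LinearEquiv.refl F _, IsAut.refl, fun g hg => ?_⟩
  obtain ⟨a, rfl, ha⟩ : ∃ a, f a = g ∧ Λ.comp a ≠ ⊥ := by
    by_contra! hbot
    exact hg (iSup₂_eq_bot.2 hbot)
  exact ⟨a, ha, (Submodule.map_id _).trans (heq ha).symm⟩

theorem IsFine.equivalent_universal1 (hF : (2 : F) ≠ 0) (hfine : IsFine.{v} Γ)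
    (hiso : Γ.Iso Γ') {g₁ g₂ : G} (hΓ' : Γ'.IsGamma1 g₁ g₂) : Γ.Equivalent (universal1 F) := by
  obtain ⟨f, rfl⟩ := hΓ'.eq_coarsen hF
  exact hiso.trans_equivalent (hfine.of_iso hiso).equivalent_of_coarsen

theorem IsFine.equivalent_universal2 (hF : (2 : F) ≠ 0) (hfine : IsFine.{v} Γ)
    (hiso : Γ.Iso Γ') {g h : G} (hΓ' : Γ'.IsGamma2 g h) (hh : h ^ 2 = 1) :
    Γ.Equivalent (universal2 hF) := by
  obtain ⟨f, rfl⟩ := hΓ'.eq_coarsen hF hh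
  exact hiso.trans_equivalent (hfine.of_iso hiso).equivalent_of_coarsen

end Grading

end FineGradings

end Kac

end

theorem theorem3p5 (F : Type w) [Field F] (hF : (2 : F) ≠ 0) (G : Type u) [CommGroup G] :
    -- the gradings of the two types are well defined
    (∀ g₁ g₂ : G, ∃! Γ : Kac.Grading F G, Γ.IsGamma1 g₁ g₂) ∧
    (∀ g h : G, h ^ 2 = 1 → h ≠ 1 → ∃! Γ : Kac.Grading F G, Γ.IsGamma2 g h) ∧
    -- every grading is isomorphic to one of them
    (∀ Γ : Kac.Grading F G,
      (∃ (g₁ g₂ : G) (Γ' : Kac.Grading F G), Γ'.IsGamma1 g₁ g₂ ∧ Γ.Iso Γ') ∨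
      (∃ (g h : G) (Γ' : Kac.Grading F G), h ^ 2 = 1 ∧ h ≠ 1 ∧ Γ'.IsGamma2 g h ∧ Γ.Iso Γ')) ∧
    -- the two types are not isomorphic
    (∀ (g₁ g₂ g h : G) (Γ Γ' : Kac.Grading F G), h ^ 2 = 1 → h ≠ 1 →
      Γ.IsGamma1 g₁ g₂ → Γ'.IsGamma2 g h → ¬ Γ.Iso Γ') ∧
    -- isomorphism within the first type
    (∀ (g₁ g₂ g₁' g₂' : G) (Γ Γ' : Kac.Grading F G),
      Γ.IsGamma1 g₁ g₂ → Γ'.IsGamma1 g₁' g₂' →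
      (Γ.Iso Γ' ↔
        ({g₁, g₁⁻¹, g₂, g₂⁻¹} : Set G) = {g₁', g₁'⁻¹, g₂', g₂'⁻¹})) ∧
    -- isomorphism within the second type
    (∀ (g h g' h' : G) (Γ Γ' : Kac.Grading F G),
      h ^ 2 = 1 → h ≠ 1 → h' ^ 2 = 1 → h' ≠ 1 →
      Γ.IsGamma2 g h → Γ'.IsGamma2 g' h' →
      (Γ.Iso Γ' ↔ h' = h ∧ g' ∈ ({g, g * h, g⁻¹, g⁻¹ * h} : Set G))) ∧
    -- exactly two fine gradings up to equivalence
    (∃ (Γ₁ : Kac.Grading F (Multiplicative (ℤ × ℤ)))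
      (Γ₂ : Kac.Grading F (Multiplicative (ℤ × ZMod 2))),
      Γ₁.IsGamma1 (Multiplicative.ofAdd (1, 0)) (Multiplicative.ofAdd (0, 1)) ∧
      Γ₂.IsGamma2 (Multiplicative.ofAdd (1, 0)) (Multiplicative.ofAdd (0, 1)) ∧
      Kac.Grading.IsFine.{v} Γ₁ ∧ Kac.Grading.IsFine.{v} Γ₂ ∧
      ¬ Γ₁.Equivalent Γ₂ ∧
      ∀ Γ : Kac.Grading F G, Kac.Grading.IsFine.{v} Γ →
        (Γ.Equivalent Γ₁ ∨ Γ.Equivalent Γ₂)) := by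
  refine ⟨Kac.Grading.existsUnique_isGamma1 hF,
    fun g h hh _ => Kac.Grading.existsUnique_isGamma2 hF g hh,
    Kac.Grading.exists_isGamma1_or_isGamma2 hF,
    fun _ _ _ _ _ _ hh hh1 hΓ hΓ' => hΓ.not_iso hF hΓ' hh hh1,
    fun _ _ _ _ _ _ hΓ hΓ' => hΓ.iso_iff hF hΓ',
    fun _ _ _ _ _ _ hh _ hh' _ hΓ hΓ' => hΓ.iso_iff hF hh hΓ' hh',
    Kac.Grading.universal1 F, Kac.Grading.universal2 hF,
    Kac.Grading.isGamma1_universal1, Kac.Grading.isGamma2_universal2 hF,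
    Kac.Grading.isFine_universal1 hF, Kac.Grading.isFine_universal2 hF,
    Kac.Grading.not_equivalent_universal hF, fun Γ hfine => ?_⟩
  rcases Γ.exists_isGamma1_or_isGamma2 hF with ⟨_, _, _, hΓ', hiso⟩ | ⟨_, _, _, hh, _, hΓ', hiso⟩
  · exact Or.inl (hfine.equivalent_universal1 hF hiso hΓ')
  · exact Or.inr (hfine.equivalent_universal2 hF hiso hΓ' hh)
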